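/- Let $p$ be a prime, $n\ge 1$, let $\zeta=\zeta_n$ be a primitive $p^n$-th root of unity, $K=\mathbb{Q}(\zeta)$, $R_n=\mathbb{Z}[\mu_{p^n},\frac1p]\subset K$, $G_n=\mathrm{Gal}(K/\mathbb{Q})$, and for $a\in(\mathbb{Z}/p^n)^\times$ let $\sigma_a\in G_n$ be given by $\sigma_a(\zeta)=\zeta^a$. Let $K_2^M(R_n)=(R_n^\times\otimes_{\mathbb Z} R_n^\times)/I_2$, where $I_2$ is generated by the $a\otimes b$ with $a+b\in\{0,1\}$, let $\widetilde K_2(R_n)$ be the quotient of $K_2^M(R_n)$ by the elements killed by $2$, a $\mathbb{Z}[G_n]$-module, and let $\{a,b\}\in\widetilde K_2(R_n)$ be the class of $a\otimes b$. Let $\Sigma_0(p^n)$ be the semigroup of integral matrices $\begin{pmatrix}a&b\\c&d\end{pmatrix}$ of positive determinant with $p\nmid a$ and $p^n\mid c$. It acts on $M=\widetilde K_2(R_n)$ on the right through the Artin nebentype character $\chi(\gamma)=\sigma_a\in\mathbb{Z}[G_n]^\times$, i.e. $m|\gamma=\chi(\gamma)m$; we also write $\chi(\lambda)=\sigma_\lambda$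 for $\lambda$ prime to $p$. Let $X_n$ be the set of $(x,y)\in(\mathbb{Z}/p^n)^2$ with $(x,y,p)=1$. An $M$-valued Manin symbol over $\Gamma_0(p^n)$ is a function $e:X_n\to M$ such that, for all $(x,y)\in X_n$ and $\lambda\in(\mathbb{Z}/p^n)^\times$: $e(\lambda x,\lambda y)=\chi(\lambda)e(x,y)$; $e(x,y)+e(y,-x)=0$; $e(x,y)+e(y,-x-y)+e(-x-y,x)=0$. It is supported at $\infty$ if $e(x,y)=0$ whenever $xy\neq0$. Let $\Delta_0$ be the group of divisors of degree $0$ on $\mathbb{P}^1(\mathbb{Q})$. An $M$-valued modular symbol over $\Gamma_0(p^n)$ is a homomorphism $\phi:\Delta_0\to M$ with $\phi|\gamma=\phi$ for all $\gamma\in\Gamma_0(p^n)$, where $(\phi|\sigma)(D)=\phi(\sigma D)|\sigma$ for $\sigma\in\Sigma_0(p^n)$. For $m\geq 1$ let $\phi|T_m=\sum_i\phi|\delta_i$, the sum over representatives $\delta_i$ of the cosets $\Gamma_0(p^n)\delta_i$ in $\Gamma_0(p^n)\begin{pmatrix}1&0\\0&m\end{pmatrix}\Gamma_0(p^n)$.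 To a modular symbol $\phi$ is attached the function $\mathbf{e}_\phi:X_n\to M$, $\mathbf{e}_\phi(\mathbf{x})=\phi\bigl(\gamma_{\mathbf{x}}((\infty)-(0))\bigr)$, where $\gamma_{\mathbf{x}}\in SL_2(\mathbb{Z})$ has bottom row congruent to $\mathbf{x}$ modulo $p^n$. Theorem. The function $e_n:X_n\to\widetilde K_2(R_n)$ defined by $$e_n(x,y)=\begin{cases}\{1-\zeta^x,1-\zeta^y\}&\text{if }x,y\ne0,\\0&\text{otherwise,}\end{cases}$$ is a $\widetilde K_2(R_n)$-valued Manin symbol over $\Gamma_0(p^n)$. There is a unique modular symbol $\phi_n$ with $\mathbf{e}_{\phi_n}=e_n$; put $e_n|T_m:=\mathbf{e}_{\phi_n|T_m}$. For $q\in\{2,3\}$ with $q\ne p$, the function $$e_n\,|\,\bigl(T_q-(q+\chi(q))\bigr)=e_n|T_q-(q+\sigma_q)\,e_n$$ is a Manin symbol supported at $\infty$. -/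

import Mathlib

open scoped MatrixGroups TensorProduct

/-! ### The semigroup `Σ₀(N)` and its characters -/

/-- `Σ₀(N)`: the integral `2 × 2` matrices of positive determinant with upper left entry prime to
`N` and lower left entry divisible by `N`. -/
def Sigma0 (N : ℕ) : Submonoid (Matrix (Fin 2) (Fin 2) ℤ) where
  carrier := {g | 0 < g.det ∧ IsCoprime (g 0 0) (N : ℤ) ∧ (N : ℤ) ∣ g 1 0}
  one_mem' := by simp [isCoprime_one_left]
  mul_mem' := by
    rintro g h ⟨hg1, hg2, hg3⟩ ⟨hh1, hh2, k, hk⟩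
    refine ⟨by rw [Matrix.det_mul]; exact mul_pos hg1 hh1, ?_, ?_⟩
    · rw [Matrix.mul_apply, Fin.sum_univ_two, hk,
        show g 0 1 * ((N : ℤ) * k) = (N : ℤ) * (g 0 1 * k) by ring]
      exact (IsCoprime.mul_left hg2 hh2).add_mul_left_left _
    · rw [Matrix.mul_apply, Fin.sum_univ_two]
      exact dvd_add (hg3.mul_right _) (Dvd.intro _ hk.symm |>.mul_left _)

/-- The action of `Σ₀(N)` on `ℙ¹(ℚ)` is through this inclusion into `GL₂(ℚ)`. -/
noncomputable def Sigma0.toGL (N : ℕ) : Sigma0 N →* GL (Fin 2) ℚ where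
  toFun g := Matrix.GeneralLinearGroup.mkOfDetNeZero ((g : Matrix (Fin 2) (Fin 2) ℤ).map (↑))
    (by
      have h : ((g : Matrix (Fin 2) (Fin 2) ℤ).map ((↑) : ℤ → ℚ)).det
          = (((g : Matrix (Fin 2) (Fin 2) ℤ).det : ℤ) : ℚ) := by
        simp [Matrix.det_fin_two]
      rw [h]
      exact_mod_cast g.2.1.ne')
  map_one' := by
    ext i j
    fin_cases i <;> fin_cases j <;> simp [Matrix.GeneralLinearGroup.mkOfDetNeZero]
  map_mul' g h := by
    ext i j
    simp [Matrix.GeneralLinearGroup.mkOfDetNeZero, Matrix.mul_apply]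

/-- The class modulo `N` of the upper left entry, a unit modulo `N`. -/
def Sigma0.upperLeft (N : ℕ) : Sigma0 N →* (ZMod N)ˣ where
  toFun g := ZMod.unitOfIsCoprime ((g : Matrix (Fin 2) (Fin 2) ℤ) 0 0) g.2.2.1
  map_one' := by
    ext
    simp [ZMod.coe_unitOfIsCoprime]
  map_mul' g h := by
    ext
    have hz : (((h : Matrix (Fin 2) (Fin 2) ℤ) 1 0 : ℤ) : ZMod N) = 0 :=
      (ZMod.intCast_zmod_eq_zero_iff_dvd _ _).2 h.2.2.2
    simp [ZMod.coe_unitOfIsCoprime, Matrix.mul_apply, Fin.sum_univ_two, hz]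

/-- The inclusion `Γ₀(N) ⊆ Σ₀(N)`. -/
def Gamma0ToSigma0 (N : ℕ) : CongruenceSubgroup.Gamma0 N →* Sigma0 N where
  toFun γ := ⟨((γ : SL(2, ℤ)) : Matrix (Fin 2) (Fin 2) ℤ), by
    obtain ⟨γ, hγ⟩ := γ
    have hd : (N : ℤ) ∣ γ 1 0 := (ZMod.intCast_zmod_eq_zero_iff_dvd _ _).1 hγ
    refine ⟨by simp, ?_, hd⟩
    obtain ⟨k, hk⟩ := hd
    have h1 := Matrix.det_fin_two (γ : Matrix (Fin 2) (Fin 2) ℤ)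
    rw [γ.det_coe] at h1
    refine ⟨γ 1 1, -(γ 0 1 * k), ?_⟩
    have hk' : (γ : Matrix (Fin 2) (Fin 2) ℤ) 1 0 = N * k := hk
    rw [hk'] at h1
    linear_combination -h1⟩
  map_one' := rfl
  map_mul' γ δ := by
    ext1
    simp

/-- A nebentype character with values in `Aˣ` is given by a character `χ` of `(ℤ/N)ˣ`; its value
at `g ∈ Σ₀(N)` is `χ(a)`, with `a` the upper left entry of `g`. -/
def nebentype {N : ℕ} {A : Type*} [Ring A] (χ : (ZMod N)ˣ →* Aˣ) : Sigma0 N →* Aˣ :=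
  χ.comp (Sigma0.upperLeft N)

/-! ### Modular symbols -/

/-- The degree of a divisor on `ℙ¹(ℚ)`. -/
noncomputable def divDegree : (OnePoint ℚ →₀ ℤ) →+ ℤ :=
  Finsupp.liftAddHom (fun _ => AddMonoidHom.id ℤ)

/-- The divisors of degree `0` on `ℙ¹(ℚ)`. -/
noncomputable def Div0 : AddSubgroup (OnePoint ℚ →₀ ℤ) := divDegree.ker

/-- The divisor `(r) - (s)`. -/
noncomputable def Div0.sub (r s : OnePoint ℚ) : Div0 :=
  ⟨Finsupp.single r 1 - Finsupp.single s 1, by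
    simp only [Div0, AddMonoidHom.mem_ker, map_sub, divDegree, Finsupp.liftAddHom_apply_single,
      sub_self]⟩

/-- The action of `GL₂(ℚ)` on divisors, by fractional linear transformations of `ℙ¹(ℚ)`. -/
noncomputable def divAct (g : GL (Fin 2) ℚ) : (OnePoint ℚ →₀ ℤ) →+ (OnePoint ℚ →₀ ℤ) :=
  Finsupp.mapDomain.addMonoidHom (fun r : OnePoint ℚ => g • r)

theorem divAct_single (g : GL (Fin 2) ℚ) (r : OnePoint ℚ) (k : ℤ) :
    divAct g (Finsupp.single r k) = Finsupp.single (g • r) k :=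
  Finsupp.mapDomain_single

theorem divDegree_divAct (g : GL (Fin 2) ℚ) : divDegree.comp (divAct g) = divDegree := by
  refine Finsupp.addHom_ext fun r k => ?_
  rw [AddMonoidHom.comp_apply, divAct_single, divDegree, Finsupp.liftAddHom_apply_single,
    Finsupp.liftAddHom_apply_single]

/-- The action of `GL₂(ℚ)` on divisors of degree `0`. -/
noncomputable def Div0.act (g : GL (Fin 2) ℚ) : Div0 →+ Div0 :=
  ((divAct g).comp Div0.subtype).codRestrict Div0 (fun D => by
    have h : divDegree (divAct g D) = divDegree D := DFunLike.congr_fun (divDegree_divAct g) D.1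
    exact h.trans D.2)

theorem Div0.act_one (D : Div0) : Div0.act 1 D = D := by
  have h : divAct 1 = AddMonoidHom.id _ :=
    Finsupp.addHom_ext fun r k => by rw [divAct_single, one_smul]; rfl
  exact Subtype.ext (DFunLike.congr_fun h D.1)

theorem Div0.act_mul (g h : GL (Fin 2) ℚ) (D : Div0) :
    Div0.act (g * h) D = Div0.act g (Div0.act h D) := by
  have e : divAct (g * h) = (divAct g).comp (divAct h) :=
    Finsupp.addHom_ext fun r k => by
      rw [AddMonoidHom.comp_apply, divAct_single, divAct_single, divAct_single, mul_smul]
  exact Subtype.ext (DFunLike.congr_fun e D.1)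

section ModularSymbols

variable {N : ℕ} {A : Type*} [Ring A] {M : Type*} [AddCommGroup M] [Module A M]

/-- The right action `(φ|σ)(D) = φ(σ D)|σ` of `Σ₀(N)` on `Hom(Δ₀, M)`, where `Σ₀(N)` acts on `M`
through the nebentype character, `m|σ = χ(σ) m`. -/
noncomputable def slash (χ : (ZMod N)ˣ →* Aˣ) (φ : Div0 →+ M) (σ : Sigma0 N) : Div0 →+ M :=
  ((nebentype χ σ : Aˣ) : A) • φ.comp (Div0.act (Sigma0.toGL N σ))

theorem slash_apply (χ : (ZMod N)ˣ →* Aˣ) (φ : Div0 →+ M) (σ : Sigma0 N) (D : Div0) :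
    slash χ φ σ D = ((nebentype χ σ : Aˣ) : A) • φ (Div0.act (Sigma0.toGL N σ) D) := rfl

theorem slash_mul (χ : (ZMod N)ˣ →* Aˣ) (φ : Div0 →+ M) (σ τ : Sigma0 N) :
    slash χ φ (σ * τ) = slash χ (slash χ φ σ) τ := by
  ext D
  have h : nebentype χ (σ * τ) = nebentype χ τ * nebentype χ σ := by
    rw [nebentype, MonoidHom.comp_apply, MonoidHom.comp_apply, MonoidHom.comp_apply, ← map_mul,
      map_mul (Sigma0.upperLeft N), mul_comm]
  rw [slash_apply, slash_apply, slash_apply, ← mul_smul, h, Units.val_mul, map_mul, Div0.act_mul]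

/-- The `M`-valued modular symbols over `Γ₀(N)`. -/
def Symb (χ : (ZMod N)ˣ →* Aˣ) (M : Type*) [AddCommGroup M] [Module A M] :
    AddSubgroup (Div0 →+ M) where
  carrier := {φ | ∀ γ : CongruenceSubgroup.Gamma0 N, slash χ φ (Gamma0ToSigma0 N γ) = φ}
  zero_mem' γ := by
    ext D
    simp [slash_apply]
  add_mem' {φ ψ} hφ hψ γ := by
    ext D
    have h1 := DFunLike.congr_fun (hφ γ) D
    have h2 := DFunLike.congr_fun (hψ γ) D
    rw [slash_apply] at h1 h2 ⊢
    rw [AddMonoidHom.add_apply, AddMonoidHom.add_apply, smul_add, h1, h2]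
  neg_mem' {φ} hφ γ := by
    ext D
    have h1 := DFunLike.congr_fun (hφ γ) D
    rw [slash_apply] at h1 ⊢
    rw [AddMonoidHom.neg_apply, AddMonoidHom.neg_apply, smul_neg, h1]

/-! ### Hecke operators -/

/-- The double coset `Γ₀(N) diag(1, m) Γ₀(N)`. -/
def DoubleCoset0 (N m : ℕ) : Type :=
  {σ : Sigma0 N // ∃ γ₁ γ₂ : CongruenceSubgroup.Gamma0 N,
    (σ : Matrix (Fin 2) (Fin 2) ℤ) =
      (Gamma0ToSigma0 N γ₁ : Matrix (Fin 2) (Fin 2) ℤ) * !![1, 0; 0, (m : ℤ)] *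
        (Gamma0ToSigma0 N γ₂ : Matrix (Fin 2) (Fin 2) ℤ)}

/-- Two elements of the double coset are equivalent when they lie in the same coset `Γ₀(N) σ`. -/
def leftCosetSetoid (N m : ℕ) : Setoid (DoubleCoset0 N m) where
  r σ τ := ∃ γ : CongruenceSubgroup.Gamma0 N, τ.1 = Gamma0ToSigma0 N γ * σ.1
  iseqv :=
    { refl := fun σ => ⟨1, by simp⟩
      symm := by
        rintro σ τ ⟨γ, h⟩
        exact ⟨γ⁻¹, by rw [h, ← mul_assoc, ← map_mul, inv_mul_cancel, map_one, one_mul]⟩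
      trans := by
        rintro σ τ υ ⟨γ, h⟩ ⟨δ, h'⟩
        exact ⟨δ * γ, by rw [h', h, map_mul, mul_assoc]⟩ }

/-- The set of cosets `Γ₀(N) \ Γ₀(N) diag(1, m) Γ₀(N)`. -/
def HeckeCosets (N m : ℕ) : Type := Quotient (leftCosetSetoid N m)

/-- A representative of a coset. -/
noncomputable def HeckeCosets.rep {N m : ℕ} (c : HeckeCosets N m) : Sigma0 N :=
  (Quotient.out (s := leftCosetSetoid N m) c).1

/-- Right translation of the cosets by an element of `Γ₀(N)`. -/
def HeckeCosets.translate {N m : ℕ} (γ : CongruenceSubgroup.Gamma0 N) :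
    HeckeCosets N m → HeckeCosets N m :=
  Quotient.map' (s₁ := leftCosetSetoid N m) (s₂ := leftCosetSetoid N m)
    (fun σ => ⟨σ.1 * Gamma0ToSigma0 N γ, by
      obtain ⟨γ₁, γ₂, h⟩ := σ.2
      exact ⟨γ₁, γ₂ * γ, by rw [Submonoid.coe_mul, h, map_mul, Submonoid.coe_mul, mul_assoc]⟩⟩)
    (by
      rintro σ τ ⟨δ, h⟩
      exact ⟨δ, by simp only [h, mul_assoc]⟩)

theorem HeckeCosets.translate_translate {N m : ℕ} (γ δ : CongruenceSubgroup.Gamma0 N)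
    (h : γ * δ = 1) (c : HeckeCosets N m) : (c.translate γ).translate δ = c := by
  induction c using Quotient.inductionOn with
  | h σ =>
    refine congrArg (Quotient.mk (leftCosetSetoid N m)) (Subtype.ext ?_)
    change σ.1 * Gamma0ToSigma0 N γ * Gamma0ToSigma0 N δ = σ.1
    rw [mul_assoc, ← map_mul, h, map_one, mul_one]

theorem slash_rep_mk (χ : (ZMod N)ˣ →* Aˣ) (φ : Symb χ M) {m : ℕ} (σ : DoubleCoset0 N m) :
    slash χ φ.1 (HeckeCosets.rep (Quotient.mk (leftCosetSetoid N m) σ)) = slash χ φ.1 σ.1 := by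
  obtain ⟨γ, h⟩ := Quotient.mk_out (s := leftCosetSetoid N m) σ
  rw [h, slash_mul, φ.2 γ]
  rfl

/-- The Hecke operator `φ ↦ φ|T_m = ∑ φ|δ`, the sum over representatives `δ` of the finitely many
cosets `Γ₀(N) δ` in `Γ₀(N) diag(1, m) Γ₀(N)`. -/
noncomputable def heckeT (χ : (ZMod N)ˣ →* Aˣ) (m : ℕ) (φ : Symb χ M) : Symb χ M :=
  ⟨∑ᶠ c : HeckeCosets N m, slash χ φ.1 c.rep, by
    intro γ
    let L : (Div0 →+ M) →+ (Div0 →+ M) :=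
      { toFun := fun ψ => slash χ ψ (Gamma0ToSigma0 N γ)
        map_zero' := by ext D; simp [slash_apply]
        map_add' := by intro a b; ext D; simp [slash_apply] }
    have hinj : Function.Injective L := by
      intro a b hab
      have h2 : slash χ (slash χ a (Gamma0ToSigma0 N γ)) (Gamma0ToSigma0 N γ⁻¹)
          = slash χ (slash χ b (Gamma0ToSigma0 N γ)) (Gamma0ToSigma0 N γ⁻¹) :=
        congrArg (fun ψ => slash χ ψ (Gamma0ToSigma0 N γ⁻¹)) hab
      rw [← slash_mul, ← slash_mul, ← map_mul, mul_inv_cancel, map_one] at h2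
      have h1 : ∀ ψ : Div0 →+ M, slash χ ψ 1 = ψ := by
        intro ψ
        ext D
        rw [slash_apply, map_one, map_one, Units.val_one, one_smul, Div0.act_one]
      rwa [h1, h1] at h2
    change L (∑ᶠ c : HeckeCosets N m, slash χ φ.1 c.rep) = _
    have hmap : L (∑ᶠ c : HeckeCosets N m, slash χ φ.1 c.rep)
        = ∑ᶠ c : HeckeCosets N m, L (slash χ φ.1 c.rep) :=
      AddMonoidHom.map_finsum_of_injective L hinj _
    rw [hmap]
    let E : HeckeCosets N m ≃ HeckeCosets N m :=
      { toFun := HeckeCosets.translate γ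
        invFun := HeckeCosets.translate γ⁻¹
        left_inv := fun c => HeckeCosets.translate_translate γ γ⁻¹ (mul_inv_cancel γ) c
        right_inv := fun c => HeckeCosets.translate_translate γ⁻¹ γ (inv_mul_cancel γ) c }
    refine finsum_eq_of_bijective E E.bijective (fun c => ?_)
    induction c using Quotient.inductionOn with
    | h σ =>
      change slash χ (slash χ φ.1 (HeckeCosets.rep (Quotient.mk (leftCosetSetoid N m) σ)))
        (Gamma0ToSigma0 N γ) = _
      rw [slash_rep_mk, ← slash_mul]
      exact (slash_rep_mk χ φ ⟨σ.1 * Gamma0ToSigma0 N γ, _⟩).symm⟩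

end ModularSymbols

/-! ### Manin symbols -/

/-- The set `X_N` of primitive row vectors in `(ℤ/N)²`. -/
def ManinX (N : ℕ) : Type := {v : ZMod N × ZMod N // IsCoprime v.1 v.2}

namespace ManinX

variable {N : ℕ}

/-- The vector `(λx, λy)`. -/
def scale (u : (ZMod N)ˣ) (v : ManinX N) : ManinX N :=
  ⟨(u * v.1.1, u * v.1.2), (isCoprime_mul_unit_left u.isUnit _ _).2 v.2⟩

/-- The vector `(y, -x)`. -/
def rotS (v : ManinX N) : ManinX N :=
  ⟨(v.1.2, -v.1.1), v.2.symm.neg_right⟩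

/-- The vector `(y, -x-y)`. -/
def rotT (v : ManinX N) : ManinX N :=
  ⟨(v.1.2, -v.1.1 - v.1.2), by
    obtain ⟨a, b, h⟩ := v.2
    exact ⟨b - a, -a, by linear_combination h⟩⟩

/-- The vector `(-x-y, x)`. -/
def rotT2 (v : ManinX N) : ManinX N :=
  ⟨(-v.1.1 - v.1.2, v.1.1), by
    obtain ⟨a, b, h⟩ := v.2
    exact ⟨-b, a - b, by linear_combination h⟩⟩

/-- Every primitive vector modulo `N` is the reduction of the bottom row of a matrix in `SL₂(ℤ)`. -/
theorem exists_SL2 (v : ManinX N) :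
    ∃ γ : SL(2, ℤ), ((γ 1 0 : ℤ) : ZMod N) = v.1.1 ∧ ((γ 1 1 : ℤ) : ZMod N) = v.1.2 := by
  obtain ⟨⟨x, y⟩, hxy⟩ := v
  obtain ⟨c, rfl⟩ := ZMod.intCast_surjective x
  obtain ⟨d, rfl⟩ := ZMod.intCast_surjective y
  suffices h : ∃ c' d' : ℤ, IsCoprime c' d' ∧ (c' : ZMod N) = c ∧ (d' : ZMod N) = d by
    obtain ⟨c', d', ⟨a, b, hab⟩, hc, hd⟩ := h
    exact ⟨⟨!![b, -a; c', d'], by rw [Matrix.det_fin_two_of]; linear_combination hab⟩, hc, hd⟩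
  obtain ⟨a, b, hab⟩ := hxy
  obtain ⟨a, rfl⟩ := ZMod.intCast_surjective a
  obtain ⟨b, rfl⟩ := ZMod.intCast_surjective b
  have hab' : ((a * c + b * d - 1 : ℤ) : ZMod N) = 0 := by
    push_cast
    linear_combination hab
  obtain ⟨w, hw⟩ := (ZMod.intCast_zmod_eq_zero_iff_dvd _ _).1 hab'
  -- replace `c` by a nonzero lift when possible
  obtain ⟨c', hc', a', hw', hne⟩ : ∃ c' : ℤ, (c' : ZMod N) = c ∧
      ∃ w' : ℤ, a * c' + b * d + w' * N = 1 ∧ (c' ≠ 0 ∨ (N : ℤ) = 0 ∧ c' = 0) := by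
    by_cases hc0 : c = 0
    · refine ⟨c + N, by simp, -w - a, by linear_combination hw, ?_⟩
      by_cases hN : (N : ℤ) = 0
      · exact Or.inr ⟨hN, by simp [hc0, hN]⟩
      · exact Or.inl (by simpa [hc0] using hN)
    · exact ⟨c, rfl, -w, by linear_combination hw, Or.inl hc0⟩
  rcases hne with hne | ⟨hN, hc0⟩
  · -- lift the unit `d` modulo `gcd(c', N)` to a unit modulo `c'`
    have : NeZero c'.natAbs := ⟨by simpa using hne⟩
    set g : ℕ := Nat.gcd c'.natAbs N with hg
    have hgc : g ∣ c'.natAbs := Nat.gcd_dvd_left _ _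
    have hgc' : (g : ℤ) ∣ c' := Int.natCast_dvd.2 hgc
    have hgN : (g : ℤ) ∣ N := Int.natCast_dvd_natCast.2 (Nat.gcd_dvd_right _ _)
    have hcop : IsCoprime d (g : ℤ) := by
      obtain ⟨s, hs⟩ := hgc'
      obtain ⟨t, ht⟩ := hgN
      exact ⟨b, a * s + a' * t, by rw [hs, ht] at hw'; linear_combination hw'⟩
    obtain ⟨u, hu⟩ := ZMod.unitsMap_surjective hgc (ZMod.unitOfIsCoprime d hcop)
    have hu1 : ((u.val.val : ℤ) : ZMod g) = (d : ZMod g) := by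
      have h1 := congrArg Units.val hu
      rw [ZMod.unitsMap_val, ZMod.coe_unitOfIsCoprime] at h1
      rw [← h1, ZMod.cast_eq_val]
      simp
    obtain ⟨k, hk⟩ := (ZMod.intCast_eq_intCast_iff_dvd_sub _ _ _).1 hu1.symm
    have hucop : IsCoprime c' (u.val.val : ℤ) := by
      have h1 : Nat.Coprime u.val.val c'.natAbs := ZMod.val_coe_unit_coprime u
      rw [Int.isCoprime_iff_gcd_eq_one, Int.gcd_comm]
      exact h1
    have hbez : (g : ℤ) = c' * Int.gcdA c' N + N * Int.gcdB c' N := by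
      have h1 := Int.gcd_eq_gcd_ab c' N
      rw [← h1, hg]
      simp [Int.gcd]
    refine ⟨c', d + k * Int.gcdB c' N * N, ?_, hc', by simp⟩
    have : d + k * Int.gcdB c' N * N = u.val.val + c' * (-(k * Int.gcdA c' N)) := by
      rw [hbez] at hk
      linear_combination -hk
    rw [this]
    exact hucop.add_mul_left_right _
  · exact ⟨c', d, ⟨a, b, by rw [hN] at hw'; linear_combination hw'⟩, hc', rfl⟩

/-- A section `v ↦ γ_v` of `γ ↦ (0, 1) γ`, from `X_N` to `SL₂(ℤ)`. -/
noncomputable def lift (v : ManinX N) : SL(2, ℤ) := (exists_SL2 v).choose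

end ManinX

section ManinSymbols

variable {N : ℕ} {A : Type*} [Ring A]

/-- The `M`-valued Manin symbols over `Γ₀(N)`, for the nebentype character `χ`. -/
def Manin (χ : (ZMod N)ˣ →* Aˣ) (M : Type*) [AddCommGroup M] [Module A M] :
    AddSubgroup (ManinX N → M) where
  carrier := {e | (∀ (u : (ZMod N)ˣ) (v : ManinX N), e (v.scale u) = (χ u : A) • e v) ∧
    (∀ v : ManinX N, e v + e v.rotS = 0) ∧
    (∀ v : ManinX N, e v + e v.rotT + e v.rotT2 = 0)}
  zero_mem' := by simp
  add_mem' := by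
    rintro e f ⟨h1, h2, h3⟩ ⟨k1, k2, k3⟩
    refine ⟨fun u v => ?_, fun v => ?_, fun v => ?_⟩
    · simp only [Pi.add_apply, h1, k1, smul_add]
    · simp only [Pi.add_apply]
      rw [add_add_add_comm, h2, k2, add_zero]
    · simp only [Pi.add_apply]
      rw [add_add_add_comm (e v), add_add_add_comm, h3, k3, add_zero]
  neg_mem' := by
    rintro e ⟨h1, h2, h3⟩
    refine ⟨fun u v => ?_, fun v => ?_, fun v => ?_⟩
    · simp only [Pi.neg_apply, h1, smul_neg]
    · simp only [Pi.neg_apply]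
      rw [← neg_add, h2, neg_zero]
    · simp only [Pi.neg_apply]
      rw [← neg_add, ← neg_add, h3, neg_zero]

/-- The Manin symbols supported at `∞`: those vanishing at every `(x, y)` with `xy ≠ 0`. -/
def ManinInf (χ : (ZMod N)ˣ →* Aˣ) (M : Type*) [AddCommGroup M] [Module A M] :
    AddSubgroup (ManinX N → M) where
  carrier := {e | e ∈ Manin χ M ∧ ∀ v : ManinX N, v.1.1 * v.1.2 ≠ 0 → e v = 0}
  zero_mem' := ⟨zero_mem _, by simp⟩
  add_mem' := by
    rintro e f ⟨h1, h2⟩ ⟨k1, k2⟩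
    exact ⟨add_mem h1 k1, fun v hv => by simp [h2 v hv, k2 v hv]⟩
  neg_mem' := by
    rintro e ⟨h1, h2⟩
    exact ⟨neg_mem h1, fun v hv => by simp [h2 v hv]⟩

/-- The function `v ↦ φ(γ_v((∞) - (0)))` on `X_N` attached to a modular symbol `φ`. -/
noncomputable def maninOf {χ : (ZMod N)ˣ →* Aˣ} {M : Type*} [AddCommGroup M] [Module A M]
    (φ : Symb χ M) : ManinX N → M := fun v =>
  φ.1 (Div0.act (Matrix.SpecialLinearGroup.mapGL ℚ v.lift)
    (Div0.sub OnePoint.infty ((0 : ℚ) : OnePoint ℚ)))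

end ManinSymbols

/-! ### Milnor's `K₂` -/

section K2

/-- The subgroup `I₂` of `Rˣ ⊗ Rˣ` generated by the `a ⊗ b` with `a + b ∈ {0, 1}`. -/
def steinbergRel (R : Type*) [CommRing R] : AddSubgroup (Additive Rˣ ⊗[ℤ] Additive Rˣ) :=
  AddSubgroup.closure {t | ∃ a b : Rˣ, ((a : R) + b = 0 ∨ (a : R) + b = 1) ∧
    t = Additive.ofMul a ⊗ₜ[ℤ] Additive.ofMul b}

/-- `K₂ᴹ(R) = (Rˣ ⊗ Rˣ) / I₂`, written additively. -/
abbrev K2M (R : Type*) [CommRing R] : Type _ := (Additive Rˣ ⊗[ℤ] Additive Rˣ) ⧸ steinbergRel R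

/-- The subgroup of all elements killed by `2`. -/
def K2M.twoTorsion (R : Type*) [CommRing R] : AddSubgroup (K2M R) :=
  (zsmulAddGroupHom (2 : ℤ) : K2M R →+ K2M R).ker

/-- The quotient of `K₂ᴹ(R)` by its `2`-torsion. -/
def K2tilde (R : Type*) [CommRing R] : Type _ := K2M R ⧸ K2M.twoTorsion R

noncomputable instance (R : Type*) [CommRing R] : AddCommGroup (K2tilde R) :=
  inferInstanceAs (AddCommGroup (K2M R ⧸ K2M.twoTorsion R))

variable {R S T : Type*} [CommRing R] [CommRing S] [CommRing T]

/-- The Steinberg symbol `{a, b}`, modulo `2`-torsion. -/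
def K2tilde.symbol (a b : Rˣ) : K2tilde R :=
  QuotientAddGroup.mk' (K2M.twoTorsion R)
    (QuotientAddGroup.mk' (steinbergRel R) (Additive.ofMul a ⊗ₜ[ℤ] Additive.ofMul b))

/-- The map induced on `Rˣ ⊗ Rˣ` by a ring homomorphism. -/
noncomputable def unitsTensorMap (f : R →+* S) :
    Additive Rˣ ⊗[ℤ] Additive Rˣ →+ Additive Sˣ ⊗[ℤ] Additive Sˣ :=
  (TensorProduct.map
    (MonoidHom.toAdditive (Units.map (f : R →* S))).toIntLinearMap
    (MonoidHom.toAdditive (Units.map (f : R →* S))).toIntLinearMap).toAddMonoidHom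

/-- Functoriality of `K₂ᴹ`. -/
noncomputable def K2M.map (f : R →+* S) : K2M R →+ K2M S :=
  QuotientAddGroup.map _ _ (unitsTensorMap f) (by
    refine (AddSubgroup.closure_le _).2 ?_
    rintro _ ⟨a, b, hab, rfl⟩
    refine AddSubgroup.subset_closure
      ⟨Units.map (f : R →* S) a, Units.map (f : R →* S) b, ?_, rfl⟩
    simp only [Units.coe_map, MonoidHom.coe_coe, ← map_add]
    rcases hab with h | h
    · exact Or.inl (by rw [h, map_zero])
    · exact Or.inr (by rw [h, map_one]))

/-- Functoriality of `K₂ᴹ` modulo `2`-torsion. -/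
noncomputable def K2tilde.map (f : R →+* S) : K2tilde R →+ K2tilde S :=
  QuotientAddGroup.map _ _ (K2M.map f) (by
    intro t ht
    have h : (2 : ℤ) • t = 0 := ht
    change (2 : ℤ) • K2M.map f t = 0
    rw [← map_zsmul, h, map_zero])

theorem K2tilde.map_symbol (f : R →+* S) (a b : Rˣ) :
    K2tilde.map f (K2tilde.symbol a b) =
      K2tilde.symbol (Units.map (f : R →* S) a) (Units.map (f : R →* S) b) := rfl

/-- Two additive maps out of `K2tilde R` which agree on symbols are equal. -/
theorem K2tilde.hom_ext {B : Type*} [AddCommGroup B] {f g : K2tilde R →+ B}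
    (h : ∀ a b : Rˣ, f (K2tilde.symbol a b) = g (K2tilde.symbol a b)) : f = g := by
  refine QuotientAddGroup.addMonoidHom_ext (K2M.twoTorsion R) ?_
  refine QuotientAddGroup.addMonoidHom_ext (steinbergRel R) ?_
  ext t
  induction t using TensorProduct.induction_on with
  | zero => simp
  | tmul a b => exact h a.toMul b.toMul
  | add s t hs ht => rw [map_add, map_add, hs, ht]

/-- A group acting on `R` by ring automorphisms acts on `K₂ᴹ(R)` modulo `2`-torsion, with
`σ {a, b} = {σ a, σ b}`. -/
noncomputable def K2tilde.action (G R : Type*) [Group G] [CommRing R] [MulSemiringAction G R] :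
    G →* Module.End ℤ (K2tilde R) where
  toFun σ := (K2tilde.map (MulSemiringAction.toRingHom G R σ)).toIntLinearMap
  map_one' := by
    have h : K2tilde.map (MulSemiringAction.toRingHom G R 1) = AddMonoidHom.id (K2tilde R) := by
      refine K2tilde.hom_ext fun a b => ?_
      rw [K2tilde.map_symbol]
      exact congrArg₂ K2tilde.symbol (Units.ext (one_smul G (a : R))) (Units.ext (one_smul G (b : R)))
    rw [h]
    rfl
  map_mul' σ τ := by
    have h : K2tilde.map (MulSemiringAction.toRingHom G R (σ * τ)) =
        (K2tilde.map (MulSemiringAction.toRingHom G R σ)).comp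
          (K2tilde.map (MulSemiringAction.toRingHom G R τ)) := by
      refine K2tilde.hom_ext fun a b => ?_
      rw [AddMonoidHom.comp_apply, K2tilde.map_symbol, K2tilde.map_symbol, K2tilde.map_symbol]
      exact congrArg₂ K2tilde.symbol (Units.ext (mul_smul σ τ (a : R)))
        (Units.ext (mul_smul σ τ (b : R)))
    rw [h]
    rfl

/-- `K₂ᴹ(R)` modulo `2`-torsion as a module over the group ring `ℤ[G]`. -/
noncomputable instance K2tilde.groupRingModule (G R : Type*) [Group G] [CommRing R]
    [MulSemiringAction G R] : Module (MonoidAlgebra ℤ G) (K2tilde R) :=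
  Module.compHom (K2tilde R)
    (MonoidAlgebra.lift ℤ (Module.End ℤ (K2tilde R)) G (K2tilde.action G R)).toRingHom

end K2

/-! ### The ring of `p`-integers of the cyclotomic field -/

section Cyclotomic

variable (p n : ℕ) (K : Type*) [Field K]

/-- `R_n = ℤ[μ_{p^n}, 1/p]`. -/
def cycRing : Subalgebra ℤ K :=
  Algebra.adjoin ℤ ({z : K | z ^ (p ^ n) = 1} ∪ {(p : K)⁻¹})


variable [NumberField K]

/-- The Galois group acts on `R_n`. -/
noncomputable instance cycRing.galAction :
    MulSemiringAction Gal(K/ℚ) (cycRing p n K) where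
  smul σ r := ⟨σ r, by
    have hle : cycRing p n K ≤ (cycRing p n K).comap ((σ : K →ₐ[ℚ] K).restrictScalars ℤ) := by
      refine Algebra.adjoin_le ?_
      rintro z (hz | hz)
      · refine Algebra.subset_adjoin (Or.inl ?_)
        change σ z ^ (p ^ n) = 1
        rw [← map_pow, show z ^ (p ^ n) = 1 from hz, map_one]
      · refine Algebra.subset_adjoin (Or.inr ?_)
        change σ z = (p : K)⁻¹
        rw [show z = (p : K)⁻¹ from hz, map_inv₀, map_natCast]
    exact hle r.2⟩
  one_smul r := rfl
  mul_smul σ τ r := rfl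
  smul_zero σ := Subtype.ext (map_zero σ)
  smul_add σ r s := Subtype.ext (map_add σ (r : K) s)
  smul_one σ := Subtype.ext (map_one σ)
  smul_mul σ r s := Subtype.ext (map_mul σ (r : K) s)

variable {p n K}

/-- The element `ζ^x` of `R_n`, for `x ∈ ℤ/p^n` and `ζ` a root of unity of order `p^n`. -/
def zetaPow {ζ : K} (hζ : IsPrimitiveRoot ζ (p ^ n)) (x : ZMod (p ^ n)) : cycRing p n K :=
  ⟨ζ ^ x.val, Algebra.subset_adjoin (Or.inl (by
    change (ζ ^ x.val) ^ (p ^ n) = 1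
    rw [← pow_mul, mul_comm, pow_mul, hζ.pow_eq_one, one_pow]))⟩

theorem isUnit_one_sub_zetaPow [Fact p.Prime] {ζ : K} (hζ : IsPrimitiveRoot ζ (p ^ n))
    {x : ZMod (p ^ n)} (hx : x ≠ 0) : IsUnit (1 - zetaPow hζ x) := by
  have hp : p.Prime := Fact.out
  have : NeZero (p ^ n) := ⟨(pow_pos hp.pos n).ne'⟩
  set η : cycRing p n K := zetaPow hζ x with hη
  have hη1 : η ≠ 1 := by
    intro h
    have h1 : ζ ^ x.val = 1 := congrArg Subtype.val h
    have h2 := Nat.le_of_dvd (Nat.pos_of_ne_zero fun h0 => hx ((ZMod.val_eq_zero x).1 h0))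
      (hζ.dvd_of_pow_eq_one _ h1)
    exact absurd (ZMod.val_lt x) (not_lt.2 h2)
  have hηp : η ^ (p ^ n) = 1 := by
    refine Subtype.ext ?_
    change (ζ ^ x.val) ^ (p ^ n) = 1
    rw [← pow_mul, mul_comm, pow_mul, hζ.pow_eq_one, one_pow]
  obtain ⟨k, -, hk⟩ := (Nat.dvd_prime_pow hp).1 (orderOf_dvd_of_pow_eq_one hηp)
  have hk0 : k ≠ 0 := by
    rintro rfl
    exact hη1 (orderOf_eq_one_iff.1 (by simpa using hk))
  obtain ⟨k, rfl⟩ := Nat.exists_eq_succ_of_ne_zero hk0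
  have hprim : IsPrimitiveRoot η (p ^ (k + 1)) := hk ▸ IsPrimitiveRoot.orderOf η
  have hdvd : (1 - η) ∣ (p : cycRing p n K) := by
    have h1 : Polynomial.eval 1 (Polynomial.cyclotomic (p ^ (k + 1)) (cycRing p n K)) = p :=
      Polynomial.eval_one_cyclotomic_prime_pow k
    rw [← h1, Polynomial.cyclotomic_eq_prod_X_sub_primitiveRoots hprim, Polynomial.eval_prod]
    have h2 : η ∈ primitiveRoots (p ^ (k + 1)) (cycRing p n K) :=
      (mem_primitiveRoots (pow_pos hp.pos _)).2 hprim
    have h3 := Finset.dvd_prod_of_mem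
      (fun μ => Polynomial.eval 1 (Polynomial.X - Polynomial.C μ)) h2
    simpa using h3
  have hpu : IsUnit (p : cycRing p n K) := by
    refine IsUnit.of_mul_eq_one ⟨(p : K)⁻¹, Algebra.subset_adjoin (Or.inr rfl)⟩ (Subtype.ext ?_)
    change ((p : cycRing p n K) : K) * (p : K)⁻¹ = 1
    have h4 : ((p : cycRing p n K) : K) = (p : K) := by simp
    rw [h4, mul_inv_cancel₀ (Nat.cast_ne_zero.2 hp.ne_zero)]
  exact isUnit_of_dvd_unit hdvd hpu

/-- The unit `1 - ζ^x` of `R_n`, for `x ≠ 0`. -/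
noncomputable def cycUnit [Fact p.Prime] {ζ : K} (hζ : IsPrimitiveRoot ζ (p ^ n))
    {x : ZMod (p ^ n)} (hx : x ≠ 0) : (cycRing p n K)ˣ :=
  (isUnit_one_sub_zetaPow hζ hx).unit

open Classical in
/-- The function `e_n(x, y) = {1 - ζ^x, 1 - ζ^y}` if `x, y ≠ 0`, and `0` otherwise. -/
noncomputable def steinbergManin [Fact p.Prime] {ζ : K} (hζ : IsPrimitiveRoot ζ (p ^ n)) :
    ManinX (p ^ n) → K2tilde (cycRing p n K) := fun v =>
  if h : v.1.1 ≠ 0 ∧ v.1.2 ≠ 0 then K2tilde.symbol (cycUnit hζ h.1) (cycUnit hζ h.2) else 0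

/-- The Artin character `(ℤ/p^n)ˣ → ℤ[G_n]ˣ`, `a ↦ σ_a`, where `σ_a(ζ) = ζ^a` for all `p^n`-th roots
of unity `ζ`. -/
noncomputable def artinChar (p n : ℕ) [Fact p.Prime] (K : Type*) [Field K] [NumberField K]
    [IsCyclotomicExtension {p ^ n} ℚ K] :
    (ZMod (p ^ n))ˣ →* (MonoidAlgebra ℤ Gal(K/ℚ))ˣ :=
  haveI : NeZero (p ^ n) := ⟨(pow_pos (Fact.out : p.Prime).pos n).ne'⟩
  (Units.map (MonoidAlgebra.of ℤ Gal(K/ℚ))).comp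
    ((toUnits : Gal(K/ℚ) ≃* (Gal(K/ℚ))ˣ).toMonoidHom.comp
      (IsCyclotomicExtension.Rat.galEquivZMod (p ^ n) K).symm.toMonoidHom)

end Cyclotomic

/-! Manin symbols and modular symbols are the same thing. The divisors g((∞) - (0)), g ∈ SL₂(ℤ),
generate `Div0`, because every rational is joined to ∞ by a chain of cusps with decreasing
denominators. Manin's two- and three-term relations are the only relations between them: a function
f on SL₂(ℤ) satisfying both is the difference of a potential on ℙ¹(ℚ), obtained by summing f along
these chains (`potential_sub`). Equivariance under Γ₀(N) amounts to homogeneity in the bottom row.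
This gives existence and uniqueness of φ.

For q prime to N, the cosets of Γ₀(N) in the double coset of diag(1, q) correspond to those of
SL₂(ℤ) in all integral matrices of determinant q, so Hermite normal forms represent them. For q = 2,
3 the residues mod q can be taken in {0, ±1}, so each divisor (∞) - (r/q) splits into at most two
unimodular ones. Hence e|T_q is an explicit sum of values of e, with 4 terms for q = 2 and 6 terms
for q = 3.

On the K-theory side, put X = ζ^x and Y = ζ^y. If ua + vb = c with u, v among ±ζ^i, then {ua/c,
vb/c} = 0 expands to {a, b} = {a, c} + {c, b}, provided that ζ and -1 have trivial symbols with
everything involved (`K2tilde.symbol_eq_add`). For -1 this is the effect of dividing by 2-torsion;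
for ζ it is `oneSubUnit_mem_orth`. Three identities are then used: (1 - X) + X(1 - Y) = 1 - XY,
which gives the three-term relation for e_n; (1 + X) - X(1 + Y) = 1 - XY, for T₂; (1 + Y + Y²) -
(Y/X)(1 + X + X²) = (1 - XY)(1 - Y/X), for T₃. As 1 + X and 1 + X + X² are the quotients (1 -
X^q)/(1 - X), expanding bilinearly shows that the explicit sum is q e(x, y) + e(qx, qy) when x, y ≠
0, and e(qx, qy) = σ_q e(x, y). -/

/-! ### Cusps and divisors of degree `0` -/

/-- An integral matrix of nonzero determinant, as an element of `GL₂(ℚ)`. -/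
noncomputable def intGL (m : Matrix (Fin 2) (Fin 2) ℤ) (hm : m.det ≠ 0) : GL (Fin 2) ℚ :=
  Matrix.GeneralLinearGroup.mkOfDetNeZero (m.map (↑)) (by
    have h : (m.map ((↑) : ℤ → ℚ)).det = ((m.det : ℤ) : ℚ) := by simp [Matrix.det_fin_two]
    rw [h]
    exact_mod_cast hm)

theorem intGL_apply (m : Matrix (Fin 2) (Fin 2) ℤ) (hm : m.det ≠ 0) (i j : Fin 2) :
    intGL m hm i j = (m i j : ℚ) := rfl

theorem intGL_mul (m m' : Matrix (Fin 2) (Fin 2) ℤ) (hm : m.det ≠ 0) (hm' : m'.det ≠ 0)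
    (h : (m * m').det ≠ 0) : intGL (m * m') h = intGL m hm * intGL m' hm' := by
  ext i j
  simp [intGL_apply, Matrix.mul_apply]

theorem toGL_eq_intGL (N : ℕ) (σ : Sigma0 N) : Sigma0.toGL N σ = intGL σ.1 σ.2.1.ne' := rfl

theorem mapGL_eq_intGL (g : SL(2, ℤ)) :
    Matrix.SpecialLinearGroup.mapGL ℚ g = intGL g.1 (by simp) := by
  ext i j
  simp [intGL_apply]

theorem toGL_Gamma0ToSigma0 (N : ℕ) (γ : CongruenceSubgroup.Gamma0 N) :
    Sigma0.toGL N (Gamma0ToSigma0 N γ) = Matrix.SpecialLinearGroup.mapGL ℚ (γ : SL(2, ℤ)) := by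
  rw [mapGL_eq_intGL]
  rfl

/-- The point `a / b` of `ℙ¹(ℚ)`. -/
def cusp (a b : ℤ) : OnePoint ℚ := if b = 0 then OnePoint.infty else ((a / b : ℚ) : OnePoint ℚ)

theorem intGL_smul_infty (m : Matrix (Fin 2) (Fin 2) ℤ) (hm : m.det ≠ 0) :
    intGL m hm • (OnePoint.infty : OnePoint ℚ) = cusp (m 0 0) (m 1 0) := by
  simp [OnePoint.smul_infty_eq_ite, cusp, intGL_apply]

theorem intGL_smul_zero (m : Matrix (Fin 2) (Fin 2) ℤ) (hm : m.det ≠ 0) :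
    intGL m hm • ((0 : ℚ) : OnePoint ℚ) = cusp (m 0 1) (m 1 1) := by
  simp [OnePoint.smul_some_eq_ite, cusp, intGL_apply]

theorem mapGL_smul_infty (g : SL(2, ℤ)) :
    Matrix.SpecialLinearGroup.mapGL ℚ g • (OnePoint.infty : OnePoint ℚ) =
      cusp (g 0 0) (g 1 0) := by
  rw [mapGL_eq_intGL, intGL_smul_infty]

theorem mapGL_smul_zero (g : SL(2, ℤ)) :
    Matrix.SpecialLinearGroup.mapGL ℚ g • ((0 : ℚ) : OnePoint ℚ) = cusp (g 0 1) (g 1 1) := by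
  rw [mapGL_eq_intGL, intGL_smul_zero]

theorem cusp_neg (a b : ℤ) : cusp (-a) (-b) = cusp a b := by
  simp [cusp]

theorem Div0.act_sub (g : GL (Fin 2) ℚ) (r s : OnePoint ℚ) :
    Div0.act g (Div0.sub r s) = Div0.sub (g • r) (g • s) := by
  refine Subtype.ext ?_
  change divAct g (Finsupp.single r 1 - Finsupp.single s 1) = _
  rw [map_sub, divAct_single, divAct_single]
  rfl

theorem Div0.sub_add_sub (r s t : OnePoint ℚ) :
    Div0.sub r s + Div0.sub s t = Div0.sub r t :=
  Subtype.ext (sub_add_sub_cancel _ _ _)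

theorem Div0.sub_self (r : OnePoint ℚ) : Div0.sub r r = 0 :=
  Subtype.ext (_root_.sub_self _)

/-- The divisor `g((∞) - (0))`. -/
noncomputable def uniDiv (g : SL(2, ℤ)) : Div0 :=
  Div0.act (Matrix.SpecialLinearGroup.mapGL ℚ g)
    (Div0.sub OnePoint.infty ((0 : ℚ) : OnePoint ℚ))

theorem uniDiv_eq (g : SL(2, ℤ)) :
    uniDiv g = Div0.sub (cusp (g 0 0) (g 1 0)) (cusp (g 0 1) (g 1 1)) := by
  rw [uniDiv, Div0.act_sub, mapGL_smul_infty, mapGL_smul_zero]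

theorem act_uniDiv (g h : SL(2, ℤ)) :
    Div0.act (Matrix.SpecialLinearGroup.mapGL ℚ g) (uniDiv h) = uniDiv (g * h) := by
  rw [uniDiv, uniDiv, ← Div0.act_mul, map_mul]

/-- The map `L`, sending D to D - deg(D)(∞), is the identity in degree 0 and has values in the span
of the (r) - (∞). -/
theorem Div0.hom_ext_sub {M : Type*} [AddCommGroup M] {φ ψ : Div0 →+ M}
    (h : ∀ r, φ (Div0.sub r OnePoint.infty) = ψ (Div0.sub r OnePoint.infty)) : φ = ψ := by
  let L : (OnePoint ℚ →₀ ℤ) →+ Div0 :=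
    Finsupp.liftAddHom fun r => zmultiplesHom Div0 (Div0.sub r OnePoint.infty)
  have hL : ∀ D : OnePoint ℚ →₀ ℤ,
      (L D : OnePoint ℚ →₀ ℤ) = D - Finsupp.single OnePoint.infty (divDegree D) := by
    intro D
    induction D using Finsupp.induction_linear with
    | zero => simp
    | add f g hf hg =>
      rw [map_add, AddSubgroup.coe_add, hf, hg, map_add, Finsupp.single_add]
      abel
    | single r k =>
      simp only [L, Finsupp.liftAddHom_apply_single, zmultiplesHom_apply, divDegree,
        AddMonoidHom.id_apply, AddSubgroup.coe_zsmul]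
      simp [Div0.sub, smul_sub]
  have hc : φ.comp L = ψ.comp L := by
    refine Finsupp.addHom_ext fun r k => ?_
    simp only [L, AddMonoidHom.comp_apply, Finsupp.liftAddHom_apply_single, zmultiplesHom_apply,
      map_zsmul, h]
  ext D
  have hD : L D.1 = D := by
    refine Subtype.ext ?_
    rw [hL, show divDegree D.1 = 0 from D.2]
    simp
  have := DFunLike.congr_fun hc D.1
  rwa [AddMonoidHom.comp_apply, AddMonoidHom.comp_apply, hD] at this

/-- A rational `r` is `g ∞` for a `g ∈ SL₂(ℤ)` such that `g 0` has smaller denominator. -/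
theorem exists_parent (r : ℚ) : ∃ g : SL(2, ℤ), g 0 0 = r.num ∧ g 1 0 = r.den ∧
    0 ≤ g 1 1 ∧ g 1 1 < r.den := by
  have hc : IsCoprime r.num (r.den : ℤ) := r.isCoprime_num_den
  obtain ⟨u, v, huv⟩ := hc
  have hd : (r.den : ℤ) ≠ 0 := by exact_mod_cast r.den_nz
  have hd' : 0 < (r.den : ℤ) := by exact_mod_cast r.den_pos
  -- Subtracting a multiple of the first column from the second keeps the determinant and reduces
  -- the Bézout coefficient `u` modulo the denominator.
  refine ⟨⟨!![r.num, -(v + r.num * (u / r.den)); r.den, u % r.den], ?_⟩, rfl, rfl,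
    Int.emod_nonneg _ hd, Int.emod_lt_of_pos _ hd'⟩
  rw [Matrix.det_fin_two_of]
  linear_combination huv + r.num * Int.emod_add_mul_ediv u r.den

/-- A choice of the matrix in `exists_parent`. -/
noncomputable def parent (r : ℚ) : SL(2, ℤ) := (exists_parent r).choose

theorem parent_spec (r : ℚ) : parent r 0 0 = r.num ∧ parent r 1 0 = r.den ∧
    0 ≤ parent r 1 1 ∧ parent r 1 1 < r.den := (exists_parent r).choose_spec

theorem cusp_num_den (r : ℚ) : cusp r.num r.den = (r : OnePoint ℚ) := by
  simp [cusp, Rat.num_div_den]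

theorem cusp_parent (r : ℚ) : cusp (parent r 0 0) (parent r 1 0) = (r : OnePoint ℚ) := by
  rw [(parent_spec r).1, (parent_spec r).2.1, cusp_num_den]

theorem den_parent_lt (r : ℚ) (h : parent r 1 1 ≠ 0) :
    ((parent r 0 1 : ℚ) / (parent r 1 1 : ℚ)).den < r.den := by
  obtain ⟨-, -, h0, h1⟩ := parent_spec r
  have h2 : ((((parent r 0 1 : ℚ) / (parent r 1 1 : ℚ)).den : ℤ)) ∣ parent r 1 1 := by
    rw [← Rat.divInt_eq_div]
    exact Rat.den_dvd _ _
  have h3 := Int.le_of_dvd (lt_of_le_of_ne h0 h.symm) h2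
  omega

/-- The divisors g((∞) - (0)) generate `Div0`: going from r to the cusp g0, where g is `parent r`,
costs one of them and lowers the denominator, until ∞ is reached. -/
theorem Div0.hom_ext_uniDiv {M : Type*} [AddCommGroup M] {φ ψ : Div0 →+ M}
    (h : ∀ g, φ (uniDiv g) = ψ (uniDiv g)) : φ = ψ := by
  refine Div0.hom_ext_sub fun r => ?_
  induction r using OnePoint.rec with
  | infty => rw [Div0.sub_self, map_zero, map_zero]
  | coe r =>
    induction hk : r.den using Nat.strong_induction_on generalizing r with
    | _ k ih =>
      have e : Div0.sub (r : OnePoint ℚ) OnePoint.infty = uniDiv (parent r) +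
          Div0.sub (cusp (parent r 0 1) (parent r 1 1)) OnePoint.infty := by
        rw [uniDiv_eq, Div0.sub_add_sub, cusp_parent]
      rw [e, map_add, map_add, h]
      congr 1
      by_cases h0 : parent r 1 1 = 0
      · rw [cusp, if_pos h0, Div0.sub_self, map_zero, map_zero]
      · rw [cusp, if_neg h0]
        exact ih _ (hk ▸ den_parent_lt r h0) _ rfl

/-! ### Manin's presentation of `Δ₀` -/

/-- The matrix in `SL₂(ℤ)` with the given entries. -/
def sl2 (a b c d : ℤ) (h : a * d - b * c = 1) : SL(2, ℤ) :=
  ⟨!![a, b; c, d], by rw [Matrix.det_fin_two_of, h]⟩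

theorem sl2_det (g : SL(2, ℤ)) : g 0 0 * g 1 1 - g 0 1 * g 1 0 = 1 := by
  rw [← Matrix.det_fin_two, g.det_coe]

theorem sl2_eta (g : SL(2, ℤ)) : sl2 (g 0 0) (g 0 1) (g 1 0) (g 1 1) (sl2_det g) = g := by
  ext i j
  fin_cases i <;> fin_cases j <;> rfl

section Presentation

variable {M : Type*} [AddCommGroup M]

/-- The functions on `SL₂(ℤ)` which satisfy Manin's two- and three-term relations. -/
structure IsManinFun (f : SL(2, ℤ) → M) : Prop where
  two_term : ∀ a b c d h h', f (sl2 a b c d h) + f (sl2 b (-a) d (-c) h') = 0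
  three_term : ∀ a b c d h h' h'', f (sl2 a b c d h) + f (sl2 b (-a - b) d (-c - d) h') +
    f (sl2 (-a - b) a (-c - d) c h'') = 0

/-- The function on `ℙ¹(ℚ)`, zero at `∞`, obtained by summing `f` along the chain of parents. -/
noncomputable def potentialRat (f : SL(2, ℤ) → M) (r : ℚ) : M :=
  open Classical in
  f (parent r) + if _h : parent r 1 1 = 0 then 0 else
    potentialRat f ((parent r 0 1 : ℚ) / (parent r 1 1 : ℚ))
termination_by r.den
decreasing_by exact den_parent_lt r _h

/-- The extension of `potentialRat` to `ℙ¹(ℚ)`. -/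
noncomputable def potential (f : SL(2, ℤ) → M) : OnePoint ℚ → M := fun r => r.elim 0 (potentialRat f)

theorem potential_coe (f : SL(2, ℤ) → M) (r : ℚ) :
    potential f r = f (parent r) + potential f (cusp (parent r 0 1) (parent r 1 1)) := by
  change potentialRat f r = _
  rw [potentialRat, cusp]
  congr 1
  split_ifs <;> rfl

variable {f : SL(2, ℤ) → M}

/-- The two-term relation, applied twice, compares f at g and at gS², and S² = -1. -/
theorem IsManinFun.neg (hf : IsManinFun f) (a b c d : ℤ) (h h') :
    f (sl2 (-a) (-b) (-c) (-d) h) = f (sl2 a b c d h') := by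
  have h1 := hf.two_term a b c d h' (by linear_combination h')
  have h2 := hf.two_term b (-a) d (-c) (by linear_combination h') (by linear_combination h')
  rw [add_comm] at h1
  exact (add_right_injective _ (h1.trans h2.symm)).symm

/-- The bounds 0 ≤ d < c and the determinant determine the second column from the first, so the
matrix is the chosen parent of a/c and the recursion for the potential applies. -/
theorem potential_of_lt (a b c d : ℤ) (h : a * d - b * c = 1) (hd : 0 ≤ d) (hdc : d < c) :
    potential f (cusp a c) = f (sl2 a b c d h) + potential f (cusp b d) := by
  have hc : 0 < c := hd.trans_lt hdc
  have hcop : Nat.Coprime a.natAbs c.natAbs :=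
    Int.isCoprime_iff_gcd_eq_one.1 ⟨d, -b, by linear_combination h⟩
  have hnum := Rat.num_div_eq_of_coprime hc hcop
  have hden := Rat.den_div_eq_of_coprime hc hcop
  set r : ℚ := (a : ℚ) / c with hr
  have hcu : cusp a c = (r : OnePoint ℚ) := by rw [cusp, if_neg hc.ne']
  obtain ⟨h1, h2, h3, h4⟩ := parent_spec r
  rw [hnum] at h1
  rw [hden] at h2 h4
  have hdet := sl2_det (parent r)
  rw [h1, h2] at hdet
  have hdvd : c ∣ d - parent r 1 1 := by
    have h5 : IsCoprime c a := ⟨-b, d, by linear_combination h⟩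
    refine h5.dvd_of_dvd_mul_left ⟨b - parent r 0 1, ?_⟩
    linear_combination h - hdet
  have hd' : d = parent r 1 1 := by
    have := Int.eq_zero_of_abs_lt_dvd hdvd (abs_lt.2 ⟨by linarith, by linarith⟩)
    linarith
  have hb' : b = parent r 0 1 := by
    have : c * (b - parent r 0 1) = 0 := by
      linear_combination hdet - h + a * hd'
    rcases mul_eq_zero.1 this with h0 | h0
    · exact absurd h0 hc.ne'
    · linarith
  have hpar : parent r = sl2 a b c d h := by
    rw [← sl2_eta (parent r)]
    congr 1
    exacts [hb'.symm, hd'.symm]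
  rw [hcu, potential_coe, ← hb', ← hd', hpar]

/-- Induction on the lower right entry, by Euclid's algorithm on the bottom row. The three-term
relation supplies the step from (c, n) to (c, n - c). -/
theorem potential_of_nonneg (hf : IsManinFun f) (n : ℕ) : ∀ (a b c : ℤ) (h : a * n - b * c = 1),
    0 ≤ c → potential f (cusp a c) - potential f (cusp b n) = f (sl2 a b c n h) := by
  induction n using Nat.strong_induction_on with
  | _ n ih =>
    intro a b c h hc
    rcases lt_or_ge (n : ℤ) c with hlt | hge
    · rw [potential_of_lt a b c n h (by positivity) hlt, add_sub_cancel_right]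
    · have hS := hf.two_term a b c n h (by linear_combination h)
      -- If c = 0 the matrix is a translation; rotating it by S gives bottom row (1, 0), which
      -- `potential_of_lt` covers.
      rcases hc.eq_or_lt with rfl | hc'
      · have hn1 : (n : ℤ) = 1 := by
          have : (n : ℤ) ∣ 1 := ⟨a, by linear_combination -h⟩
          exact Int.eq_one_of_dvd_one (by positivity) this
        have ha1 : a = 1 := by
          rw [hn1] at h
          linarith
        have h1 := potential_of_lt (f := f) b (-a) n (-0) (by linear_combination h) (by simp)
          (by rw [hn1]; simp)
        have h0 : ∀ x : ℤ, cusp x 0 = OnePoint.infty := fun x => by simp [cusp]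
        simp only [neg_zero, h0] at h1 hS
        rw [h0, h1]
        rw [eq_neg_of_add_eq_zero_left hS]
        abel
      -- Here a/c, b/n and (b - a)/(n - c) are the vertices of a Farey triangle. The edge from the
      -- first to the third has a smaller lower right entry, and the edge from the second to the
      -- third falls under `potential_of_lt`.
      · have hm : ((n - c.toNat : ℕ) : ℤ) = n - c := by omega
        have h1 := ih (n - c.toNat) (by omega) a (b - a) c
          (by rw [hm]; linear_combination h) hc
        have h2 := potential_of_lt (f := f) b (b - a) n (n - c) (by linear_combination h)
          (by linarith) (by linarith)
        have h3 := hf.three_term a (b - a) c (n - c) (by linear_combination h)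
          (by linear_combination h) (by linear_combination h)
        have h4 := hf.two_term b (b - a) n (n - c) (by linear_combination h)
          (by linear_combination h)
        have h5 := hf.neg b (-a) n (-c) (by linear_combination h) (by linear_combination h)
        have e1 : f (sl2 (b - a) (-a - (b - a)) (n - c) (-c - (n - c)) (by linear_combination h))
            = f (sl2 (b - a) (-b) (n - c) (-n) (by linear_combination h)) := by
          congr 2 <;> ring
        have e2 : f (sl2 (-a - (b - a)) a (-c - (n - c)) c (by linear_combination h))
            = f (sl2 (-b) (- -a) (-n) (- -c) (by linear_combination h)) := by
          congr 2 <;> ring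
        rw [e1, e2, h5] at h3
        simp only [hm] at h1
        have h6 : f (sl2 a b c n h) = f (sl2 a (b - a) c (n - c) (by linear_combination h)) -
            f (sl2 b (b - a) n (n - c) (by linear_combination h)) := by
          rw [eq_neg_of_add_eq_zero_left hS, neg_eq_of_add_eq_zero_left h3,
            eq_neg_of_add_eq_zero_left h4]
          abel
        rw [h6, ← h1, h2]
        abel

/-- Both sides change in the same way under g ↦ -g and g ↦ gS, which reduces to a nonnegative bottom
row. -/
theorem potential_sub (hf : IsManinFun f) (g : SL(2, ℤ)) :
    potential f (cusp (g 0 0) (g 1 0)) - potential f (cusp (g 0 1) (g 1 1)) = f g := by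
  suffices h : ∀ (a b c d : ℤ) (h : a * d - b * c = 1),
      potential f (cusp a c) - potential f (cusp b d) = f (sl2 a b c d h) by
    rw [h _ _ _ _ (sl2_det g), sl2_eta]
  have h1 : ∀ (a b c d : ℤ) (h : a * d - b * c = 1), 0 ≤ d → 0 ≤ c →
      potential f (cusp a c) - potential f (cusp b d) = f (sl2 a b c d h) := by
    intro a b c d h hd hc
    lift d to ℕ using hd
    exact potential_of_nonneg hf d a b c h hc
  have h2 : ∀ (a b c d : ℤ) (h : a * d - b * c = 1), 0 ≤ d →
      potential f (cusp a c) - potential f (cusp b d) = f (sl2 a b c d h) := by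
    intro a b c d h hd
    rcases le_total 0 c with hc | hc
    · exact h1 a b c d h hd hc
    · have h3 := h1 b (-a) d (-c) (by linear_combination h) (by linarith) hd
      have h4 := hf.two_term a b c d h (by linear_combination h)
      rw [cusp_neg] at h3
      rw [eq_neg_of_add_eq_zero_left h4, ← h3]
      abel
  intro a b c d h
  rcases le_total 0 d with hd | hd
  · exact h2 a b c d h hd
  · have h3 := h2 (-a) (-b) (-c) (-d) (by linear_combination h) (by linarith)
    rwa [cusp_neg, cusp_neg, hf.neg _ _ _ _ _ h] at h3

/-- The homomorphism `(r) - (s) ↦ h(r) - h(s)`. -/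
noncomputable def homOfPotential (h : OnePoint ℚ → M) : Div0 →+ M :=
  (Finsupp.liftAddHom fun r => zmultiplesHom M (h r)).comp Div0.subtype

theorem homOfPotential_sub (h : OnePoint ℚ → M) (r s : OnePoint ℚ) :
    homOfPotential h (Div0.sub r s) = h r - h s := by
  change Finsupp.liftAddHom (fun r => zmultiplesHom M (h r))
    (Finsupp.single r 1 - Finsupp.single s 1) = _
  rw [map_sub, Finsupp.liftAddHom_apply_single, Finsupp.liftAddHom_apply_single]
  simp

/-- Manin's theorem: a function on `SL₂(ℤ)` which satisfies the two- and three-term relations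
comes from a homomorphism on `Δ₀`. -/
theorem IsManinFun.exists_hom (hf : IsManinFun f) : ∃ φ : Div0 →+ M, ∀ g, φ (uniDiv g) = f g :=
  ⟨homOfPotential (potential f), fun g => by
    rw [uniDiv_eq, homOfPotential_sub, potential_sub hf]⟩

theorem isManinFun_uniDiv (φ : Div0 →+ M) : IsManinFun fun g => φ (uniDiv g) where
  two_term a b c d h h' := by
    have e1 : uniDiv (sl2 a b c d h) = Div0.sub (cusp a c) (cusp b d) := uniDiv_eq _
    have e2 : uniDiv (sl2 b (-a) d (-c) h') = Div0.sub (cusp b d) (cusp (-a) (-c)) := uniDiv_eq _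
    rw [← map_add, e1, e2, cusp_neg, Div0.sub_add_sub, Div0.sub_self, map_zero]
  three_term a b c d h h' h'' := by
    have e1 : uniDiv (sl2 a b c d h) = Div0.sub (cusp a c) (cusp b d) := uniDiv_eq _
    have e2 : uniDiv (sl2 b (-a - b) d (-c - d) h') =
      Div0.sub (cusp b d) (cusp (-a - b) (-c - d)) := uniDiv_eq _
    have e3 : uniDiv (sl2 (-a - b) a (-c - d) c h'') =
      Div0.sub (cusp (-a - b) (-c - d)) (cusp a c) := uniDiv_eq _
    rw [← map_add, ← map_add, e1, e2, e3, Div0.sub_add_sub, Div0.sub_add_sub, Div0.sub_self,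
      map_zero]

end Presentation

/-! ### Modular symbols and Manin symbols -/

section ModularManin

variable {N : ℕ} {A : Type*} [Ring A] {χ : (ZMod N)ˣ →* Aˣ} {M : Type*} [AddCommGroup M]
  [Module A M]

/-- The bottom row of `g` modulo `N`. -/
def bottomRow (N : ℕ) (g : SL(2, ℤ)) : ManinX N :=
  ⟨((g 1 0 : ℤ), (g 1 1 : ℤ)), by
    have h : IsCoprime (g 1 0) (g 1 1) :=
      ⟨-g 0 1, g 0 0, by linear_combination sl2_det g⟩
    exact h.map (Int.castRingHom (ZMod N))⟩

theorem bottomRow_lift (v : ManinX N) : bottomRow N v.lift = v :=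
  Subtype.ext (Prod.ext (ManinX.exists_SL2 v).choose_spec.1 (ManinX.exists_SL2 v).choose_spec.2)

theorem isManinFun_of_mem_Manin {e : ManinX N → M} (he : e ∈ Manin χ M) :
    IsManinFun fun g => e (bottomRow N g) where
  two_term a b c d h h' := by
    rw [← he.2.1 (bottomRow N (sl2 a b c d h))]
    congr 2
    refine Subtype.ext (Prod.ext rfl ?_)
    simp [bottomRow, ManinX.rotS, sl2]
  three_term a b c d h h' h'' := by
    rw [← he.2.2 (bottomRow N (sl2 a b c d h))]
    congr 2
    · congr 2
      refine Subtype.ext (Prod.ext rfl ?_)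
      simp [bottomRow, ManinX.rotT, sl2]
    · refine Subtype.ext (Prod.ext ?_ rfl)
      simp [bottomRow, ManinX.rotT2, sl2]

theorem upperLeft_mul_lowerRight (γ : CongruenceSubgroup.Gamma0 N) :
    (Sigma0.upperLeft N (Gamma0ToSigma0 N γ) : ZMod N) * ((γ : SL(2, ℤ)) 1 1 : ℤ) = 1 := by
  have h0 : (((γ : SL(2, ℤ)) 1 0 : ℤ) : ZMod N) = 0 := γ.2
  have h := congrArg (Int.cast : ℤ → ZMod N) (sl2_det (γ : SL(2, ℤ)))
  push_cast at h
  rw [h0, mul_zero, sub_zero] at h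
  exact h

/-- Modulo N, left multiplication by γ scales the bottom row by its lower right entry, which is
inverse to the upper left one. This is why the nebentype, read off the upper left entry, matches the
homogeneity of Manin symbols. -/
theorem scale_bottomRow (γ : CongruenceSubgroup.Gamma0 N) (g : SL(2, ℤ)) :
    (bottomRow N ((γ : SL(2, ℤ)) * g)).scale (Sigma0.upperLeft N (Gamma0ToSigma0 N γ)) =
      bottomRow N g := by
  have h0 : (((γ : SL(2, ℤ)) 1 0 : ℤ) : ZMod N) = 0 := γ.2
  have h := upperLeft_mul_lowerRight γ
  refine Subtype.ext (Prod.ext ?_ ?_)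
  · simp only [ManinX.scale, bottomRow, Matrix.SpecialLinearGroup.coe_mul, Matrix.mul_apply,
      Fin.sum_univ_two]
    push_cast
    rw [h0]
    linear_combination h * ((g 1 0 : ℤ) : ZMod N)
  · simp only [ManinX.scale, bottomRow, Matrix.SpecialLinearGroup.coe_mul, Matrix.mul_apply,
      Fin.sum_univ_two]
    push_cast
    rw [h0]
    linear_combination h * ((g 1 1 : ℤ) : ZMod N)

theorem exists_Symb {e : ManinX N → M} (he : e ∈ Manin χ M) :
    ∃ φ : Symb χ M, ∀ g, φ.1 (uniDiv g) = e (bottomRow N g) := by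
  obtain ⟨φ, hφ⟩ := (isManinFun_of_mem_Manin he).exists_hom
  refine ⟨⟨φ, fun γ => Div0.hom_ext_uniDiv fun g => ?_⟩, hφ⟩
  rw [slash_apply, toGL_Gamma0ToSigma0, act_uniDiv, hφ, hφ, nebentype, MonoidHom.comp_apply,
    ← he.1, scale_bottomRow]

/-- The lower left entry of gh⁻¹ is the determinant of the two bottom rows, which vanishes modulo N
when they are proportional. -/
theorem exists_smul_of_bottomRow_eq {g h : SL(2, ℤ)} (u : (ZMod N)ˣ)
    (H : (bottomRow N g).scale u = bottomRow N h) :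
    ∃ γ : CongruenceSubgroup.Gamma0 N, g = γ * h ∧
      Sigma0.upperLeft N (Gamma0ToSigma0 N γ) = u := by
  have h1 : (u : ZMod N) * (g 1 0 : ℤ) = (h 1 0 : ℤ) := congrArg (fun v => v.1.1) H
  have h2 : (u : ZMod N) * (g 1 1 : ℤ) = (h 1 1 : ℤ) := congrArg (fun v => v.1.2) H
  have hd := congrArg (Int.cast : ℤ → ZMod N) (sl2_det g)
  push_cast at hd
  have hinv : ∀ i, (g * h⁻¹) i 0 = g i 0 * h 1 1 - g i 1 * h 1 0 := by
    intro i
    simp [Matrix.SpecialLinearGroup.coe_inv, Matrix.adjugate_fin_two, Matrix.mul_apply,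
      Fin.sum_univ_two]
    ring
  have hmem : g * h⁻¹ ∈ CongruenceSubgroup.Gamma0 N := by
    rw [CongruenceSubgroup.Gamma0_mem, hinv]
    push_cast
    rw [← h1, ← h2]
    ring
  refine ⟨⟨g * h⁻¹, hmem⟩, by simp, Units.ext ?_⟩
  have h3 : (Sigma0.upperLeft N (Gamma0ToSigma0 N ⟨g * h⁻¹, hmem⟩) : ZMod N) =
      (((g * h⁻¹ : SL(2, ℤ)) 0 0 : ℤ) : ZMod N) := rfl
  rw [h3, hinv]
  push_cast
  rw [← h1, ← h2]
  linear_combination (u : ZMod N) * hd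

theorem smul_uniDiv (φ : Symb χ M) {g h : SL(2, ℤ)} (u : (ZMod N)ˣ)
    (H : (bottomRow N g).scale u = bottomRow N h) :
    (χ u : A) • φ.1 (uniDiv g) = φ.1 (uniDiv h) := by
  obtain ⟨γ, rfl, rfl⟩ := exists_smul_of_bottomRow_eq u H
  have := DFunLike.congr_fun (φ.2 γ) (uniDiv h)
  rwa [slash_apply, toGL_Gamma0ToSigma0, act_uniDiv] at this

theorem smul_uniDiv_eq_maninOf (φ : Symb χ M) (g : SL(2, ℤ)) (u : (ZMod N)ˣ) :
    (χ u : A) • φ.1 (uniDiv g) = maninOf φ ((bottomRow N g).scale u) :=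
  smul_uniDiv φ u (bottomRow_lift _).symm

theorem ManinX.scale_one (v : ManinX N) : v.scale 1 = v :=
  Subtype.ext (Prod.ext (one_mul _) (one_mul _))

theorem uniDiv_eq_maninOf (φ : Symb χ M) (g : SL(2, ℤ)) :
    φ.1 (uniDiv g) = maninOf φ (bottomRow N g) := by
  have h := smul_uniDiv_eq_maninOf φ g 1
  rwa [map_one, Units.val_one, one_smul, ManinX.scale_one] at h

theorem maninOf_mem_Manin (φ : Symb χ M) : maninOf φ ∈ Manin χ M := by
  have hf := isManinFun_uniDiv φ.1
  simp only [uniDiv_eq_maninOf] at hf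
  refine ⟨fun u v => ?_, fun v => ?_, fun v => ?_⟩
  · have h := smul_uniDiv_eq_maninOf φ v.lift u
    rw [uniDiv_eq_maninOf, bottomRow_lift] at h
    exact h.symm
  · have hd := sl2_det v.lift
    rw [← hf.two_term _ _ _ _ hd (by linear_combination hd), sl2_eta, bottomRow_lift]
    congr 2
    conv_lhs => rw [← bottomRow_lift v]
    refine Subtype.ext (Prod.ext rfl ?_)
    simp [bottomRow, ManinX.rotS, sl2]
  · have hd := sl2_det v.lift
    rw [← hf.three_term _ _ _ _ hd (by linear_combination hd) (by linear_combination hd), sl2_eta,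
      bottomRow_lift]
    congr 2
    · congr 2
      conv_lhs => rw [← bottomRow_lift v]
      refine Subtype.ext (Prod.ext rfl ?_)
      simp [bottomRow, ManinX.rotT, sl2]
    · conv_lhs => rw [← bottomRow_lift v]
      refine Subtype.ext (Prod.ext ?_ rfl)
      simp [bottomRow, ManinX.rotT2, sl2]

theorem maninOf_injective : Function.Injective (maninOf : Symb χ M → ManinX N → M) :=
  fun φ ψ h => Subtype.ext (Div0.hom_ext_uniDiv fun g => by
    rw [uniDiv_eq_maninOf, uniDiv_eq_maninOf, h])

theorem exists_maninOf_eq {e : ManinX N → M} (he : e ∈ Manin χ M) :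
    ∃ φ : Symb χ M, maninOf φ = e := by
  obtain ⟨φ, hφ⟩ := exists_Symb he
  exact ⟨φ, funext fun v => by rw [← bottomRow_lift v, ← uniDiv_eq_maninOf, hφ]⟩

end ModularManin

/-! ### Coset representatives for the Hecke operator at a prime -/

section HeckePrime

variable {N : ℕ}

/-- The matrix in `Γ₀(N)` with the given entries. -/
def gamma0Mk (N : ℕ) (a b c d : ℤ) (h : a * d - b * c = 1) (hc : (N : ℤ) ∣ c) :
    CongruenceSubgroup.Gamma0 N :=
  ⟨sl2 a b c d h, (ZMod.intCast_zmod_eq_zero_iff_dvd _ _).2 hc⟩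

theorem coe_gamma0Mk (a b c d : ℤ) (h : a * d - b * c = 1) (hc : (N : ℤ) ∣ c) :
    (Gamma0ToSigma0 N (gamma0Mk N a b c d h hc) : Matrix (Fin 2) (Fin 2) ℤ) = !![a, b; c, d] :=
  rfl

/-- Clear the first column by a matrix of Γ₀(N): its gcd g divides the upper left entry, so is prime
to N, and N still divides c/g. As g divides the prime q, the diagonal of the triangular form is (1,
q) or (q, 1). -/
theorem mem_doubleCoset_of_det_eq {q : ℕ} (hq : q.Prime) (hqN : q.Coprime N) (σ : Sigma0 N)
    (hσ : (σ : Matrix (Fin 2) (Fin 2) ℤ).det = q) :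
    ∃ γ₁ γ₂ : CongruenceSubgroup.Gamma0 N,
    (σ : Matrix (Fin 2) (Fin 2) ℤ) =
      (Gamma0ToSigma0 N γ₁ : Matrix (Fin 2) (Fin 2) ℤ) * !![1, 0; 0, (q : ℤ)] *
        (Gamma0ToSigma0 N γ₂ : Matrix (Fin 2) (Fin 2) ℤ) := by
  have ha := σ.2.2.1
  have hc := σ.2.2.2
  generalize (σ : Matrix (Fin 2) (Fin 2) ℤ) = m at hσ ha hc ⊢
  set a := m 0 0
  set b := m 0 1 with hb
  set c := m 1 0
  set d := m 1 1 with hd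
  have hm : m = !![a, b; c, d] := Matrix.eta_fin_two m
  rw [hm, Matrix.det_fin_two_of] at hσ
  have hq0 : (q : ℤ) ≠ 0 := by exact_mod_cast hq.ne_zero
  set g : ℤ := (Int.gcd a c : ℤ) with hg
  obtain ⟨a', ha'⟩ : g ∣ a := Int.gcd_dvd_left ..
  obtain ⟨c', hc'⟩ : g ∣ c := Int.gcd_dvd_right ..
  have hg0 : g ≠ 0 := by
    intro h0
    rw [h0, zero_mul] at ha' hc'
    rw [ha', hc'] at hσ
    apply hq0
    linarith
  have hgN : IsCoprime g (N : ℤ) := ha.of_isCoprime_of_dvd_left ⟨a', ha'⟩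
  have hNc' : (N : ℤ) ∣ c' := hgN.symm.dvd_of_dvd_mul_left (hc' ▸ hc)
  obtain ⟨s, t, hst⟩ : ∃ s t : ℤ, s * a' + t * c' = 1 := by
    refine ⟨Int.gcdA a c, Int.gcdB a c, mul_left_cancel₀ hg0 ?_⟩
    have h1 : g = a * Int.gcdA a c + c * Int.gcdB a c := Int.gcd_eq_gcd_ab a c
    linear_combination -h1 - Int.gcdA a c * ha' - Int.gcdB a c * hc'
  set b' := s * b + t * d with hb'
  set d' := a' * d - c' * b with hd'
  have hgd : g * d' = q := by
    rw [hd']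
    linear_combination hσ - d * ha' + b * hc'
  have hm' : m = !![a', -t; c', s] * !![g, b'; 0, d'] := by
    rw [hm]
    ext i j
    fin_cases i <;> fin_cases j <;> simp [Matrix.mul_apply, Fin.sum_univ_two]
    · linear_combination ha'
    · rw [hb', hd']
      linear_combination -b * hst
    · linear_combination hc'
    · rw [hb', hd']
      linear_combination -d * hst
  have hgq : g = 1 ∨ g = q := by
    have h1 : Int.gcd a c ∣ q := by
      rw [← Int.natCast_dvd_natCast]
      exact ⟨d', hgd.symm⟩
    rcases (Nat.dvd_prime hq).1 h1 with h | h
    · exact Or.inl (by rw [hg, h, Nat.cast_one])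
    · exact Or.inr (by rw [hg, h])
  rcases hgq with h | h
  · refine ⟨gamma0Mk N a' (-t) c' s (by linear_combination hst) hNc',
      gamma0Mk N 1 b' 0 1 (by ring) (dvd_zero _), ?_⟩
    rw [h, one_mul] at hgd
    rw [coe_gamma0Mk, coe_gamma0Mk, hm', h, hgd, mul_assoc]
    simp
  · rw [h] at hgd
    have hd1 : d' = 1 := mul_left_cancel₀ hq0 (by rw [hgd, mul_one])
    -- The relation xq + yN = 1 produces elements of Γ₀(N) which exchange diag(q, 1) and diag(1, q).
    obtain ⟨x, y, hxy⟩ := Nat.isCoprime_iff_coprime.2 hqN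
    refine ⟨gamma0Mk N a' (-t) c' s (by linear_combination hst) hNc' *
      gamma0Mk N 1 b' 0 1 (by ring) (dvd_zero _) *
      gamma0Mk N q (-y) N x (by linear_combination hxy) dvd_rfl,
      gamma0Mk N (x * q) y (-N) 1 (by linear_combination hxy) (dvd_neg.2 dvd_rfl), ?_⟩
    have e1 : (!![(q : ℤ), b'; 0, 1] : Matrix (Fin 2) (Fin 2) ℤ) =
        !![1, b'; 0, 1] * (!![(q : ℤ), -y; N, x] * !![1, 0; 0, (q : ℤ)] * !![x * q, y; -N, 1]) := by
      ext i j
      fin_cases i <;> fin_cases j <;> simp [Matrix.mul_apply, Fin.sum_univ_two]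
      · linear_combination -(q : ℤ) * hxy
      · linear_combination -b' * hxy
      · ring
      · linear_combination -hxy
    rw [map_mul, map_mul, Submonoid.coe_mul, Submonoid.coe_mul, coe_gamma0Mk, coe_gamma0Mk,
      coe_gamma0Mk, coe_gamma0Mk, hm', h, hd1, e1]
    simp only [mul_assoc]

/-- Every coset of SL₂(ℤ) in the matrices of determinant q meets the double coset, even after right
translation by γ⁻¹. The translation will let σ act directly on γ((∞) - (0)). -/
theorem exists_doubleCoset_mul_eq {q : ℕ} (hq : q.Prime) (hqN : q.Coprime N)
    (m : Matrix (Fin 2) (Fin 2) ℤ) (hm : m.det = q) (γ : SL(2, ℤ)) :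
    ∃ (α : SL(2, ℤ)) (σ : DoubleCoset0 N q), σ.1.1 * γ.1 = α.1 * m := by
  set m' := m * (γ⁻¹ : SL(2, ℤ)).1 with hm'
  have hdet' : m'.det = q := by rw [hm', Matrix.det_mul, hm, (γ⁻¹).2, mul_one]
  have hdet := hdet'
  rw [Matrix.det_fin_two] at hdet
  obtain ⟨x, y, hxy⟩ := Nat.isCoprime_iff_coprime.2 hqN
  have hqN' : IsCoprime (q : ℤ) N := ⟨x, y, hxy⟩
  -- This row, taken as the bottom row of α, kills the first column of m' modulo N. It is primitive
  -- because det m' = q is a unit modulo N.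
  have hcop : IsCoprime ((-m' 1 0 : ℤ) : ZMod N) ((m' 0 0 : ℤ) : ZMod N) := by
    refine ⟨x * (m' 0 1 : ℤ), x * (m' 1 1 : ℤ), ?_⟩
    have h1 : ((x * q + y * N : ℤ) : ZMod N) = 1 := by rw [hxy, Int.cast_one]
    have h2 := congrArg (Int.cast : ℤ → ZMod N) hdet
    push_cast at h1 h2 ⊢
    rw [ZMod.natCast_self, mul_zero, add_zero] at h1
    linear_combination h1 + (x : ZMod N) * h2
  obtain ⟨α, h0, h1⟩ := ManinX.exists_SL2 (N := N) ⟨(_, _), hcop⟩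
  have hσdet : (α.1 * m').det = q := by rw [Matrix.det_mul, α.2, one_mul, hdet']
  have h10 : (N : ℤ) ∣ (α.1 * m') 1 0 := by
    rw [← ZMod.intCast_zmod_eq_zero_iff_dvd, Matrix.mul_apply, Fin.sum_univ_two]
    simp only at h0 h1
    push_cast at h0 h1 ⊢
    linear_combination h0 * (m' 0 0 : ZMod N) + h1 * (m' 1 0 : ZMod N)
  have h00 : IsCoprime ((α.1 * m') 0 0) (N : ℤ) := by
    obtain ⟨k, hk⟩ := h10
    have h2 := hσdet
    rw [Matrix.det_fin_two, hk] at h2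
    refine ⟨x * (α.1 * m') 1 1, y - x * (α.1 * m') 0 1 * k, ?_⟩
    linear_combination hxy + x * h2
  let σ : Sigma0 N := ⟨α.1 * m', by rw [hσdet]; exact_mod_cast hq.pos, h00, h10⟩
  refine ⟨α, ⟨σ, mem_doubleCoset_of_det_eq hq hqN σ hσdet⟩, ?_⟩
  have h3 : (γ⁻¹ : SL(2, ℤ)).1 * γ.1 = 1 := by
    rw [← Matrix.SpecialLinearGroup.coe_mul, inv_mul_cancel, Matrix.SpecialLinearGroup.coe_one]
  change α.1 * (m * (γ⁻¹ : SL(2, ℤ)).1) * γ.1 = α.1 * m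
  rw [mul_assoc, mul_assoc, h3, mul_one]

variable {ι : Type*}

/-- Representatives of `SL₂(ℤ)` modulo the integral matrices of determinant `q`. -/
def hermiteRep (q : ℕ) (r : ι → ℤ) : Option ι → Matrix (Fin 2) (Fin 2) ℤ
  | none => !![(q : ℤ), 0; 0, 1]
  | some i => !![1, r i; 0, (q : ℤ)]

theorem det_hermiteRep (q : ℕ) (r : ι → ℤ) (k : Option ι) : (hermiteRep q r k).det = q := by
  cases k <;> simp [hermiteRep]

theorem hermiteRep_unique {q : ℕ} (hq : q.Prime) {r : ι → ℤ}
    (hr : ∀ a : ℤ, ∃! i, (q : ℤ) ∣ a - r i) (k l : Option ι) (β : Matrix (Fin 2) (Fin 2) ℤ)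
    (h : hermiteRep q r k = β * hermiteRep q r l) : k = l := by
  have hq1 : ¬ (q : ℤ) ∣ 1 := by
    rw [← Nat.cast_one, Int.natCast_dvd_natCast]
    exact hq.one_lt.ne' ∘ Nat.dvd_one.1
  have h00 := congrFun (congrFun h 0) 0
  have h01 := congrFun (congrFun h 0) 1
  have h11 := congrFun (congrFun h 1) 1
  rw [Matrix.mul_apply, Fin.sum_univ_two] at h00 h01 h11
  rcases k with _ | i <;> rcases l with _ | j <;> simp [hermiteRep] at h00 h01 h11
  · rfl
  · have h10 := congrFun (congrFun h 1) 0
    rw [Matrix.mul_apply, Fin.sum_univ_two] at h10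
    simp [hermiteRep] at h10
    exact absurd ⟨β 1 1, by rw [← h10, zero_mul, zero_add] at h11; linear_combination h11⟩ hq1
  · exact absurd ⟨β 0 0, by linear_combination h00⟩ hq1
  · congr 1
    refine (hr (r i)).unique (by simp) ⟨β 0 1, ?_⟩
    rw [← h00] at h01
    linear_combination h01

theorem exists_hermiteRep {q : ℕ} (hq : q.Prime) {r : ι → ℤ}
    (hr : ∀ a : ℤ, ∃! i, (q : ℤ) ∣ a - r i) (m : Matrix (Fin 2) (Fin 2) ℤ) (hm : m.det = q) :
    ∃ (k : Option ι) (β : SL(2, ℤ)), m = β.1 * hermiteRep q r k := by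
  have hq0 : (q : ℤ) ≠ 0 := by exact_mod_cast hq.ne_zero
  have hqp : Prime (q : ℤ) := Nat.prime_iff_prime_int.1 hq
  rw [Matrix.det_fin_two] at hm
  have hm' := Matrix.eta_fin_two m
  -- Modulo q the matrix is singular, so either its first column vanishes or the second is a
  -- multiple of the first.
  have key : ((q : ℤ) ∣ m 0 0 ∧ (q : ℤ) ∣ m 1 0) ∨
      ∃ i, (q : ℤ) ∣ m 0 1 - r i * m 0 0 ∧ (q : ℤ) ∣ m 1 1 - r i * m 1 0 := by
    have aux : ∀ a b c d : ℤ, a * d - b * c = q → ¬ (q : ℤ) ∣ a →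
        ∃ i, (q : ℤ) ∣ b - r i * a ∧ (q : ℤ) ∣ d - r i * c := by
      intro a b c d h ha
      obtain ⟨s, t, hst⟩ := (hqp.coprime_iff_not_dvd).2 ha
      obtain ⟨i, ⟨w, hw⟩, -⟩ := hr (t * b)
      have h1 : (q : ℤ) ∣ b - r i * a := ⟨s * b + a * w, by linear_combination a * hw - b * hst⟩
      refine ⟨i, h1, (hqp.dvd_or_dvd (a := a) ?_).resolve_left ha⟩
      obtain ⟨z, hz⟩ := h1
      exact ⟨1 + z * c, by linear_combination h + c * hz⟩
    by_cases h0 : (q : ℤ) ∣ m 0 0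
    · by_cases h1 : (q : ℤ) ∣ m 1 0
      · exact Or.inl ⟨h0, h1⟩
      · obtain ⟨i, h2, h3⟩ := aux (m 1 0) (m 1 1) (-m 0 0) (-m 0 1)
          (by linear_combination hm) h1
        refine Or.inr ⟨i, ?_, h2⟩
        have e : m 0 1 - r i * m 0 0 = -(-m 0 1 - r i * -m 0 0) := by ring
        rw [e]
        exact (dvd_neg (α := ℤ)).2 h3
    · exact Or.inr (aux _ _ _ _ hm h0)
  rcases key with ⟨⟨a, ha⟩, ⟨c, hc⟩⟩ | ⟨i, ⟨b, hb⟩, ⟨d, hd⟩⟩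
  · refine ⟨none, sl2 a (m 0 1) c (m 1 1) (mul_left_cancel₀ hq0 ?_), ?_⟩
    · linear_combination hm - m 1 1 * ha + m 0 1 * hc
    · ext i j
      fin_cases i <;> fin_cases j <;>
        simp [hermiteRep, sl2, Matrix.mul_apply, Fin.sum_univ_two, ha, hc, mul_comm]
  · refine ⟨some i, sl2 (m 0 0) b (m 1 0) d (mul_left_cancel₀ hq0 ?_), ?_⟩
    · linear_combination hm - m 0 0 * hd + m 1 0 * hb
    · ext k j
      fin_cases k <;> fin_cases j <;>
        simp [hermiteRep, sl2, Matrix.mul_apply, Fin.sum_univ_two]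
      · linear_combination hb
      · linear_combination hd

variable {A : Type*} [Ring A] {χ : (ZMod N)ˣ →* Aˣ} {M : Type*} [AddCommGroup M] [Module A M]

/-- Each coset Γ₀(N)τ corresponds to the Hermite form of τγ. The correspondence is injective because
two matrices of Σ₀(N) that differ by δ ∈ SL₂(ℤ) on the left already differ by an element of Γ₀(N):
their upper left entries are prime to N and their lower left ones divisible by N. -/
theorem heckeT_eq_sum [Fintype ι] {q : ℕ} (hq : q.Prime) {r : ι → ℤ}
    (hr : ∀ a : ℤ, ∃! i, (q : ℤ) ∣ a - r i) (φ : Symb χ M) (γ : SL(2, ℤ)) (α : Option ι → SL(2, ℤ))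
    (σ : Option ι → DoubleCoset0 N q)
    (hσ : ∀ k, (σ k).1.1 * γ.1 = (α k).1 * hermiteRep q r k) :
    (heckeT χ q φ).1 = ∑ k, slash χ φ.1 (σ k).1 := by
  have hinv : ∀ g : SL(2, ℤ), g.1 * (g⁻¹ : SL(2, ℤ)).1 = 1 ∧ (g⁻¹ : SL(2, ℤ)).1 * g.1 = 1 := by
    intro g
    constructor <;> rw [← Matrix.SpecialLinearGroup.coe_mul]
    · rw [mul_inv_cancel, Matrix.SpecialLinearGroup.coe_one]
    · rw [inv_mul_cancel, Matrix.SpecialLinearGroup.coe_one]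
  rw [← finsum_eq_sum_of_fintype]
  change ∑ᶠ c : HeckeCosets N q, slash χ φ.1 c.rep = _
  symm
  refine finsum_eq_of_bijective (fun k => Quotient.mk (leftCosetSetoid N q) (σ k)) ⟨?_, ?_⟩
    fun k => (slash_rep_mk χ φ (σ k)).symm
  · intro k l hkl
    obtain ⟨δ, hδ⟩ := Quotient.exact hkl
    have hδ' : (σ l).1.1 = (δ : SL(2, ℤ)).1 * (σ k).1.1 := congrArg Subtype.val hδ
    refine (hermiteRep_unique hq hr l k ((α l)⁻¹.1 * (δ : SL(2, ℤ)).1 * (α k).1) ?_).symm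
    rw [mul_assoc, ← hσ k, mul_assoc, ← mul_assoc (δ : SL(2, ℤ)).1, ← hδ', hσ l, ← mul_assoc,
      (hinv _).2, one_mul]
  · intro c
    induction c using Quotient.inductionOn with
    | h τ =>
      have hτ : (τ.1.1 * γ.1).det = q := by
        obtain ⟨γ₁, γ₂, h⟩ := τ.2
        rw [Matrix.det_mul, γ.2, h, Matrix.det_mul, Matrix.det_mul]
        have h1 : (Gamma0ToSigma0 N γ₁).1.det = 1 := (γ₁ : SL(2, ℤ)).2
        have h2 : (Gamma0ToSigma0 N γ₂).1.det = 1 := (γ₂ : SL(2, ℤ)).2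
        rw [h1, h2]
        simp
      obtain ⟨k, β, hβ⟩ := exists_hermiteRep hq hr _ hτ
      refine ⟨k, Quotient.sound (s := leftCosetSetoid N q) ?_⟩
      have e : τ.1.1 = (β * (α k)⁻¹ : SL(2, ℤ)).1 * (σ k).1.1 := by
        have h1 : τ.1.1 = β.1 * hermiteRep q r k * (γ⁻¹).1 := by
          rw [← hβ, mul_assoc, (hinv _).1, mul_one]
        have h2 : (σ k).1.1 = (α k).1 * hermiteRep q r k * (γ⁻¹).1 := by
          rw [← hσ, mul_assoc, (hinv _).1, mul_one]
        have h3 : β.1 = (β * (α k)⁻¹ : SL(2, ℤ)).1 * (α k).1 := by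
          rw [← Matrix.SpecialLinearGroup.coe_mul, inv_mul_cancel_right]
        rw [h1, h2, ← mul_assoc, ← mul_assoc, ← h3]
      set δ : SL(2, ℤ) := β * (α k)⁻¹ with hδ
      have hmem : δ ∈ CongruenceSubgroup.Gamma0 N := by
        rw [CongruenceSubgroup.Gamma0_mem, ZMod.intCast_zmod_eq_zero_iff_dvd]
        have h3 := congrFun (congrFun e 1) 0
        rw [Matrix.mul_apply, Fin.sum_univ_two] at h3
        have h4 : (N : ℤ) ∣ δ 1 0 * (σ k).1.1 0 0 := by
          rw [eq_sub_of_add_eq h3.symm]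
          exact dvd_sub τ.1.2.2.2 ((σ k).1.2.2.2.mul_left _)
        exact (σ k).1.2.2.1.symm.dvd_of_dvd_mul_right h4
      exact ⟨⟨δ, hmem⟩, Subtype.ext e⟩

/-- The Hecke operator at a prime `q`, on Manin symbols: if the divisors `h((∞) - (0))`, for `h` in
a system of representatives of the matrices of determinant `q`, are written as sums of divisors
`g((∞) - (0))`, with `g ∈ SL₂(ℤ)`, then `e|T_q` is the sum of the `e(v h' g)`, with `h'` the
adjugate of `h`. -/
theorem maninOf_heckeT [Fintype ι] {q : ℕ} (hq : q.Prime) (hqN : q.Coprime N) {r : ι → ℤ}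
    (hr : ∀ a : ℤ, ∃! i, (q : ℤ) ∣ a - r i) (φ : Symb χ M) {E : ZMod N → ZMod N → M}
    (hE : ∀ v, maninOf φ v = E v.1.1 v.1.2) (P : Option ι → List SL(2, ℤ))
    (hP : ∀ k, Div0.sub (cusp (hermiteRep q r k 0 0) (hermiteRep q r k 1 0))
      (cusp (hermiteRep q r k 0 1) (hermiteRep q r k 1 1)) = ((P k).map uniDiv).sum)
    (v : ManinX N) :
    maninOf (heckeT χ q φ) v = ∑ k, ((P k).map fun g =>
      E (v.1.1 * (((hermiteRep q r k).adjugate * g.1) 0 0 : ℤ) +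
          v.1.2 * (((hermiteRep q r k).adjugate * g.1) 1 0 : ℤ))
        (v.1.1 * (((hermiteRep q r k).adjugate * g.1) 0 1 : ℤ) +
          v.1.2 * (((hermiteRep q r k).adjugate * g.1) 1 1 : ℤ))).sum := by
  choose α σ hσ using fun k => exists_doubleCoset_mul_eq hq hqN (hermiteRep q r k)
    (det_hermiteRep q r k) v.lift
  change (heckeT χ q φ).1 (uniDiv v.lift) = _
  rw [heckeT_eq_sum hq hr φ v.lift α σ hσ, AddMonoidHom.finsetSum_apply]
  refine Finset.sum_congr rfl fun k _ => ?_
  have hHdet := det_hermiteRep q r k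
  have hd0 : (hermiteRep q r k).det ≠ 0 := by
    rw [hHdet]
    exact_mod_cast hq.ne_zero
  have hact : Div0.act (Sigma0.toGL N (σ k).1) (uniDiv v.lift) =
      ((P k).map fun g => uniDiv (α k * g)).sum := by
    have e1 : Sigma0.toGL N (σ k).1 * Matrix.SpecialLinearGroup.mapGL ℚ v.lift =
        Matrix.SpecialLinearGroup.mapGL ℚ (α k) * intGL (hermiteRep q r k) hd0 := by
      rw [toGL_eq_intGL, mapGL_eq_intGL, mapGL_eq_intGL, ← intGL_mul, ← intGL_mul]
      · congr 1
        exact hσ k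
      · rw [Matrix.det_mul, (α k).2, one_mul]
        exact hd0
      · rw [Matrix.det_mul, v.lift.2, mul_one]
        exact (σ k).1.2.1.ne'
    rw [uniDiv, ← Div0.act_mul, e1, Div0.act_mul, Div0.act_sub (intGL _ _), intGL_smul_infty,
      intGL_smul_zero, hP, map_list_sum, List.map_map]
    simp only [Function.comp_def, act_uniDiv]
  rw [slash_apply, hact, map_list_sum, List.map_map, List.smul_sum, List.map_map]
  congr 2
  funext g
  simp only [Function.comp_apply]
  rw [nebentype, MonoidHom.comp_apply, smul_uniDiv_eq_maninOf, hE]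
  set u := Sigma0.upperLeft N (σ k).1 with hu
  have hu' : (u : ZMod N) = ((σ k).1.1 0 0 : ℤ) := ZMod.coe_unitOfIsCoprime _ (σ k).1.2.2.1
  set H := hermiteRep q r k with hH
  have hqu : IsUnit (q : ZMod N) := (ZMod.isUnit_iff_coprime q N).2 hqN
  have hv0 : ((v.lift 1 0 : ℤ) : ZMod N) = v.1.1 := congrArg (fun v => v.1.1) (bottomRow_lift v)
  have hv1 : ((v.lift 1 1 : ℤ) : ZMod N) = v.1.2 := congrArg (fun v => v.1.2) (bottomRow_lift v)
  have h10 : (((σ k).1.1 1 0 : ℤ) : ZMod N) = 0 :=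
    (ZMod.intCast_zmod_eq_zero_iff_dvd _ _).2 (σ k).1.2.2.2
  have hdσ : (σ k).1.1.det = q := by
    have h := congrArg Matrix.det (hσ k)
    rwa [Matrix.det_mul, Matrix.det_mul, v.lift.2, (α k).2, mul_one, one_mul, hHdet] at h
  have c1 := congrArg (Int.cast : ℤ → ZMod N) ((Matrix.det_fin_two _).symm.trans hdσ)
  have c2 := congrArg (Int.cast : ℤ → ZMod N) ((Matrix.det_fin_two _).symm.trans hHdet)
  have c3 := congrArg (Int.cast : ℤ → ZMod N) (congrFun (congrFun (hσ k) 1) 0)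
  have c4 := congrArg (Int.cast : ℤ → ZMod N) (congrFun (congrFun (hσ k) 1) 1)
  simp only [Matrix.mul_apply, Fin.sum_univ_two] at c3 c4
  push_cast at c1 c2 c3 c4
  rw [h10] at c1 c3 c4
  rw [hv0] at c3
  rw [hv1] at c4
  rw [← hu'] at c1
  -- Modulo N the bottom row of σ is (0, d) with ud = q. Multiplying σγ = αH by the adjugate of H
  -- and cancelling the unit q gives u(bottom row of α) = v · adj H.
  have k0 : (u : ZMod N) * ((α k).1 1 0 : ℤ) = v.1.1 * (H 1 1 : ℤ) - v.1.2 * (H 1 0 : ℤ) := by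
    refine hqu.mul_left_cancel ?_
    linear_combination (-(u : ZMod N) * ((α k).1 1 0 : ℤ)) * c2 - (u : ZMod N) * (H 1 1 : ℤ) * c3 +
      (u : ZMod N) * (H 1 0 : ℤ) * c4 + (v.1.1 * (H 1 1 : ℤ) - v.1.2 * (H 1 0 : ℤ)) * c1
  have k1 : (u : ZMod N) * ((α k).1 1 1 : ℤ) = -v.1.1 * (H 0 1 : ℤ) + v.1.2 * (H 0 0 : ℤ) := by
    refine hqu.mul_left_cancel ?_
    linear_combination (-(u : ZMod N) * ((α k).1 1 1 : ℤ)) * c2 + (u : ZMod N) * (H 0 1 : ℤ) * c3 -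
      (u : ZMod N) * (H 0 0 : ℤ) * c4 + (-v.1.1 * (H 0 1 : ℤ) + v.1.2 * (H 0 0 : ℤ)) * c1
  have e0 : ∀ j, (u : ZMod N) * ((α k * g).1 1 j : ℤ) =
      v.1.1 * ((H.adjugate * g.1) 0 j : ℤ) + v.1.2 * ((H.adjugate * g.1) 1 j : ℤ) := by
    intro j
    rw [Matrix.SpecialLinearGroup.coe_mul, Matrix.mul_apply, Matrix.mul_apply, Matrix.mul_apply,
      Fin.sum_univ_two, Fin.sum_univ_two, Fin.sum_univ_two, Matrix.adjugate_fin_two]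
    simp only [Matrix.cons_val', Matrix.cons_val_zero, Matrix.cons_val_one, Matrix.of_apply,
      Matrix.cons_val_fin_one]
    push_cast
    linear_combination (g.1 0 j : ZMod N) * k0 + (g.1 1 j : ZMod N) * k1
  exact congrArg₂ E (e0 0) (e0 1)

end HeckePrime

/-! ### The Hecke operators `T₂` and `T₃` on Manin symbols -/

section HeckeTwoThree

variable {N : ℕ} {A : Type*} [Ring A] {χ : (ZMod N)ˣ →* Aˣ} {M : Type*} [AddCommGroup M]
  [Module A M]

theorem cusp_zero_right (a : ℤ) : cusp a 0 = OnePoint.infty := if_pos rfl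

theorem cusp_zero_left {b : ℤ} (hb : b ≠ 0) : cusp 0 b = cusp 0 1 := by
  simp [cusp, hb]

theorem uniDiv_one : uniDiv 1 = Div0.sub OnePoint.infty (cusp 0 1) := by
  rw [uniDiv_eq, ← cusp_zero_right 1]
  rfl

theorem uniDiv_one_add (q : ℤ) :
    uniDiv 1 + uniDiv (sl2 0 (-1) 1 q (by ring)) = Div0.sub OnePoint.infty (cusp (-1) q) := by
  rw [uniDiv_one, uniDiv_eq, ← Div0.sub_add_sub OnePoint.infty (cusp 0 1) (cusp (-1) q)]
  rfl

theorem coe_sl2 (a b c d : ℤ) (h : a * d - b * c = 1) :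
    (sl2 a b c d h : Matrix (Fin 2) (Fin 2) ℤ) = !![a, b; c, d] := rfl

/-- With residues 0 and -1, the only divisor to be split is (∞) - (-1/2), through the cusp 0.
Letting E be defined on all pairs avoids carrying primitivity proofs. -/
theorem maninOf_heckeT_two (hN : Nat.Coprime 2 N) (φ : Symb χ M) {E : ZMod N → ZMod N → M}
    (hE : ∀ v, maninOf φ v = E v.1.1 v.1.2) (v : ManinX N) :
    maninOf (heckeT χ 2 φ) v = E v.1.1 (2 * v.1.2) + E (2 * v.1.1) v.1.2 +
      E (2 * v.1.1) (v.1.1 + v.1.2) + E (v.1.1 + v.1.2) (2 * v.1.2) := by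
  have hr : ∀ a : ℤ, ∃! i : Fin 2, ((2 : ℕ) : ℤ) ∣ a - (![0, -1] : Fin 2 → ℤ) i := by
    intro a
    simp only [ExistsUnique, Fin.exists_fin_two, Fin.forall_fin_two, Matrix.cons_val_zero,
      Matrix.cons_val_one, Matrix.cons_val_fin_one]
    rcases Int.even_or_odd' a with ⟨k, rfl | rfl⟩
    · exact Or.inl ⟨⟨k, by push_cast; ring⟩, fun _ => trivial, fun h => by omega⟩
    · exact Or.inr ⟨⟨k + 1, by push_cast; ring⟩, fun h => by omega, fun _ => trivial⟩
  rw [maninOf_heckeT Nat.prime_two hN hr φ hE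
    (fun k => k.elim [1] ![[1], [1, sl2 0 (-1) 1 2 (by ring)]])]
  · rw [Fintype.sum_option, Fin.sum_univ_two]
    simp [hermiteRep, Matrix.adjugate_fin_two, coe_sl2, mul_comm, add_assoc]
    try trace_state
  · rintro (_ | i)
    · simp [hermiteRep, uniDiv_one, cusp_zero_right]
    · fin_cases i
      · simp [hermiteRep, uniDiv_one, cusp_zero_right, cusp_zero_left]
      · simp [hermiteRep, uniDiv_one_add, cusp_zero_right]

/-- The residues 0, -1, 1 keep every r/3 equal or Farey-adjacent to 0, so a single intermediate cusp
suffices. -/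
theorem maninOf_heckeT_three (hN : Nat.Coprime 3 N) (φ : Symb χ M) {E : ZMod N → ZMod N → M}
    (hE : ∀ v, maninOf φ v = E v.1.1 v.1.2) (v : ManinX N) :
    maninOf (heckeT χ 3 φ) v = E v.1.1 (3 * v.1.2) + E (3 * v.1.1) v.1.2 +
      E (3 * v.1.1) (v.1.1 + v.1.2) + E (v.1.1 + v.1.2) (3 * v.1.2) +
      E (3 * v.1.1) (v.1.2 - v.1.1) + E (v.1.2 - v.1.1) (-(3 * v.1.2)) := by
  have hr : ∀ a : ℤ, ∃! i : Fin 3, ((3 : ℕ) : ℤ) ∣ a - (![0, -1, 1] : Fin 3 → ℤ) i := by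
    intro a
    have h3 : a % 3 = 0 ∨ a % 3 = 1 ∨ a % 3 = 2 := by omega
    simp only [ExistsUnique, Fin.exists_fin_succ, Fin.forall_fin_succ]
    simp
    omega
  rw [maninOf_heckeT Nat.prime_three hN hr φ hE
    (fun k => k.elim [1] ![[1], [1, sl2 0 (-1) 1 3 (by ring)], [1, sl2 0 (-1) 1 (-3) (by ring)]])]
  · rw [Fintype.sum_option, Fin.sum_univ_three]
    simp [hermiteRep, Matrix.adjugate_fin_two, coe_sl2, mul_comm, add_assoc]
    rw [neg_add_eq_sub]
  · rintro (_ | i)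
    · simp [hermiteRep, uniDiv_one, cusp_zero_right]
    · fin_cases i
      · simp [hermiteRep, uniDiv_one, cusp_zero_right, cusp_zero_left]
      · simp [hermiteRep, uniDiv_one_add, cusp_zero_right]
      · simp [hermiteRep, uniDiv_one_add, cusp_zero_right, cusp_neg 1 3]

end HeckeTwoThree

/-! ### Steinberg symbols modulo `2`-torsion -/

namespace K2tilde

variable {R : Type*} [CommRing R]

theorem symbol_mul_left (a b c : Rˣ) : symbol (a * b) c = symbol a c + symbol b c := by
  simp only [symbol, ofMul_mul, TensorProduct.add_tmul, map_add]
  rfl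

theorem symbol_mul_right (a b c : Rˣ) : symbol a (b * c) = symbol a b + symbol a c := by
  simp only [symbol, ofMul_mul, TensorProduct.tmul_add, map_add]
  rfl

theorem symbol_one_left (a : Rˣ) : symbol 1 a = 0 := by
  have h := symbol_mul_left 1 1 a
  rwa [mul_one, left_eq_add] at h

theorem symbol_one_right (a : Rˣ) : symbol a 1 = 0 := by
  have h := symbol_mul_right a 1 1
  rwa [mul_one, left_eq_add] at h

theorem symbol_inv_left (a b : Rˣ) : symbol a⁻¹ b = -symbol a b := by
  have h := symbol_mul_left a⁻¹ a b
  rw [inv_mul_cancel, symbol_one_left] at h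
  exact eq_neg_of_add_eq_zero_left h.symm

theorem symbol_inv_right (a b : Rˣ) : symbol a b⁻¹ = -symbol a b := by
  have h := symbol_mul_right a b⁻¹ b
  rw [inv_mul_cancel, symbol_one_right] at h
  exact eq_neg_of_add_eq_zero_left h.symm

theorem symbol_pow_right (a b : Rˣ) (k : ℕ) : symbol a (b ^ k) = k • symbol a b := by
  induction k with
  | zero => rw [pow_zero, symbol_one_right, zero_smul]
  | succ k ih => rw [pow_succ, symbol_mul_right, ih, succ_nsmul]

theorem symbol_of_add (a b : Rˣ) (h : (a : R) + b = 0 ∨ (a : R) + b = 1) : symbol a b = 0 := by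
  have h1 : QuotientAddGroup.mk' (steinbergRel R) (Additive.ofMul a ⊗ₜ[ℤ] Additive.ofMul b) = 0 :=
    (QuotientAddGroup.eq_zero_iff _).2 (AddSubgroup.subset_closure ⟨a, b, h, rfl⟩)
  rw [symbol, h1]
  exact map_zero _

/-- Since (-1)² = 1, this symbol is killed by 2 in K₂ᴹ. It is the only point where the quotient by
2-torsion is used directly. -/
theorem symbol_neg_one_right (a : Rˣ) : symbol a (-1) = 0 := by
  refine (QuotientAddGroup.eq_zero_iff _).2 ?_
  change (2 : ℤ) • QuotientAddGroup.mk' (steinbergRel R)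
    (Additive.ofMul a ⊗ₜ[ℤ] Additive.ofMul (-1)) = 0
  rw [← map_zsmul, ← TensorProduct.tmul_smul, ← ofMul_zpow]
  have h : (-1 : Rˣ) ^ (2 : ℤ) = 1 := by norm_num
  rw [h, ofMul_one, TensorProduct.tmul_zero, map_zero]

theorem symbol_neg_right (a b : Rˣ) : symbol a (-b) = symbol a b := by
  rw [← neg_one_mul, symbol_mul_right, symbol_neg_one_right, zero_add]

theorem symbol_self (a : Rˣ) : symbol a a = 0 := by
  rw [← symbol_neg_right]
  exact symbol_of_add _ _ (Or.inl (by simp))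

theorem symbol_swap (a b : Rˣ) : symbol a b = -symbol b a := by
  have h := symbol_self (a * b)
  rw [symbol_mul_left, symbol_mul_right, symbol_mul_right, symbol_self, symbol_self, zero_add,
    add_zero] at h
  exact eq_neg_of_add_eq_zero_left h

/-- The units `x` with `{x, z} = 0`. -/
def orth (z : Rˣ) : Subgroup Rˣ where
  carrier := {x | symbol x z = 0}
  one_mem' := symbol_one_left z
  mul_mem' {a b} ha hb := by
    change symbol _ _ = 0
    rw [symbol_mul_left, show symbol a z = 0 from ha, show symbol b z = 0 from hb, add_zero]
  inv_mem' {a} ha := by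
    change symbol _ _ = 0
    rw [symbol_inv_left, show symbol a z = 0 from ha, neg_zero]

/-- The units `w`, themselves in `orth z`, with `{x, w} = 0` for all `x` in `orth z`. -/
def biorth (z : Rˣ) : Subgroup Rˣ where
  carrier := {w | w ∈ orth z ∧ ∀ x ∈ orth z, symbol x w = 0}
  one_mem' := ⟨one_mem _, fun x _ => symbol_one_right x⟩
  mul_mem' {a b} ha hb := ⟨mul_mem ha.1 hb.1, fun x hx => by
    rw [symbol_mul_right, ha.2 x hx, hb.2 x hx, add_zero]⟩
  inv_mem' {a} ha := ⟨inv_mem ha.1, fun x hx => by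
    rw [symbol_inv_right, ha.2 x hx, neg_zero]⟩

theorem self_mem_biorth (z : Rˣ) : z ∈ biorth z := ⟨symbol_self z, fun _ hx => hx⟩

theorem neg_mem_biorth {z w : Rˣ} (h : w ∈ biorth z) : -w ∈ biorth z := by
  rw [← neg_one_mul]
  refine mul_mem ⟨?_, fun x _ => symbol_neg_one_right x⟩ h
  change symbol _ _ = 0
  rw [symbol_swap, symbol_neg_one_right, neg_zero]

/-- The Steinberg relation for `ua/c + vb/c = 1`, when symbols with `u` and `v` vanish. -/
theorem symbol_eq_add {z a b c u v : Rˣ} (ha : a ∈ orth z) (hb : b ∈ orth z) (hc : c ∈ orth z)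
    (hu : u ∈ biorth z) (hv : v ∈ biorth z) (h : (u * a + v * b : R) = c) :
    symbol a b = symbol a c + symbol c b := by
  have h1 : symbol (u * a * c⁻¹) (v * b * c⁻¹) = 0 := by
    refine symbol_of_add _ _ (Or.inr ?_)
    push_cast
    rw [← add_mul, h, Units.mul_inv]
  have hub : ∀ x ∈ orth z, symbol u x = 0 := fun x hx => by
    rw [symbol_swap, hu.2 x hx, neg_zero]
  rw [mul_assoc, symbol_mul_left, hub _ (mul_mem (mul_mem hv.1 hb) (inv_mem hc)), zero_add,
    mul_assoc, symbol_mul_right, hv.2 _ (mul_mem ha (inv_mem hc)), zero_add, symbol_mul_left,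
    symbol_mul_right, symbol_mul_right, symbol_inv_left, symbol_inv_left, symbol_inv_right,
    symbol_inv_right, symbol_self, neg_zero, neg_zero, add_zero] at h1
  rw [eq_comm, ← sub_eq_zero, ← neg_eq_zero, ← h1]
  abel

theorem of_smul_symbol {G : Type*} [Group G] [MulSemiringAction G R] (g : G) (a b : Rˣ) :
    MonoidAlgebra.of ℤ G g • symbol a b =
      symbol (Units.map (MulSemiringAction.toRingHom G R g : R →* R) a)
        (Units.map (MulSemiringAction.toRingHom G R g : R →* R) b) := by
  change MonoidAlgebra.lift ℤ (Module.End ℤ (K2tilde R)) G (K2tilde.action G R)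
    (MonoidAlgebra.of ℤ G g) (symbol a b) = _
  rw [MonoidAlgebra.lift_of]
  rfl

end K2tilde

/-! ### Steinberg symbols of cyclotomic units -/

/-- Bookkeeping for T₂: `a`, `b`, `c` stand for 1 - ζ^x, 1 - ζ^y, 1 - ζ^(x+y), `p` and `q` for the
quotients (1 - ζ^(2x))/(1 - ζ^x) and (1 - ζ^(2y))/(1 - ζ^y), and a pair of letters for their symbol.
-/
theorem add_eq_of_two_relations {M : Type*} [AddCommGroup M] {ab aq pb pq ac pc cb cq : M}
    (h1 : ab = ac + cb) (h2 : pq = pc + cq) :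
    aq + ab + (pb + ab) + (pc + ac) + (cq + cb) = 2 • ab + (pq + pb + (aq + ab)) := by
  rw [h2, h1]
  abel

/-- The same for T₃, with 3 in place of 2 and `d` standing for 1 - ζ^(y-x). -/
theorem add_eq_of_three_relations {M : Type*} [AddCommGroup M]
    {ab aq pb pq ac pc cb cq ad pd db dq : M} (h1 : ab = ac + cb) (h2 : ab = ad + db)
    (h3 : pq = pc + pd + (cq + dq)) :
    aq + ab + (pb + ab) + (pc + ac) + (cq + cb) + (pd + ad) + (dq + db) =
      3 • ab + (pq + pb + (aq + ab)) := by
  have e1 : ac + cb - ab = 0 := by rw [← h1, sub_self]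
  have e2 : ad + db - ab = 0 := by rw [← h2, sub_self]
  rw [← sub_eq_zero, h3]
  calc _ = ac + cb - ab + (ad + db - ab) := by abel
    _ = 0 := by rw [e1, e2, add_zero]

theorem one_sub_pow_eq_prod {K : Type*} [Field K] {η : K} {m : ℕ} (hm : 0 < m) (hη : IsPrimitiveRoot η m) (x : K) :
    1 - x ^ m = ∏ i ∈ Finset.range m, (1 - η ^ i * x) := by
  have h := hη.pow_sub_pow_eq_prod_sub_mul 1 x hm
  rw [one_pow] at h
  rw [h]
  symm
  refine Finset.prod_nbij (fun i => η ^ i) ?_ ?_ ?_ fun _ _ => rfl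
  · intro i _
    rw [Polynomial.mem_nthRootsFinset hm, ← pow_mul, mul_comm, pow_mul, hη.pow_eq_one, one_pow]
  · intro i hi j hj hij
    exact hη.pow_inj (by simpa using hi) (by simpa using hj) hij
  · intro ξ hξ
    have h1 : ξ ^ m = 1 := by simpa [Polynomial.mem_nthRootsFinset hm] using hξ
    have : NeZero m := ⟨hm.ne'⟩
    obtain ⟨i, hi, rfl⟩ := hη.eq_pow_of_pow_eq_one h1
    exact ⟨i, by simpa using hi, rfl⟩

section CyclotomicSymbols

open K2tilde

variable {p n : ℕ} {K : Type*} [Field K]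

theorem coe_zetaPow_natCast {ζ : K} (hζ : IsPrimitiveRoot ζ (p ^ n)) (m : ℕ) :
    (zetaPow hζ (m : ZMod (p ^ n)) : K) = ζ ^ m := by
  change ζ ^ (m : ZMod (p ^ n)).val = _
  rw [ZMod.val_natCast, hζ.eq_orderOf, pow_mod_orderOf]

theorem zetaPow_zero {ζ : K} (hζ : IsPrimitiveRoot ζ (p ^ n)) : zetaPow hζ 0 = 1 :=
  Subtype.ext (by rw [← Nat.cast_zero, coe_zetaPow_natCast, pow_zero]; rfl)

variable [Fact p.Prime] {ζ : K} (hζ : IsPrimitiveRoot ζ (p ^ n))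

instance neZero_prime_pow : NeZero (p ^ n) := ⟨(pow_pos (Fact.out : p.Prime).pos n).ne'⟩

theorem zetaPow_add (x y : ZMod (p ^ n)) :
    zetaPow hζ (x + y) = zetaPow hζ x * zetaPow hζ y := by
  obtain ⟨a, rfl⟩ := ZMod.natCast_zmod_surjective x
  obtain ⟨b, rfl⟩ := ZMod.natCast_zmod_surjective y
  refine Subtype.ext ?_
  rw [← Nat.cast_add, Subalgebra.coe_mul, coe_zetaPow_natCast, coe_zetaPow_natCast,
    coe_zetaPow_natCast, pow_add]

/-- `ζ^x` as a unit. -/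
noncomputable def zetaUnit (x : ZMod (p ^ n)) : (cycRing p n K)ˣ where
  val := zetaPow hζ x
  inv := zetaPow hζ (-x)
  val_inv := by rw [← zetaPow_add, add_neg_cancel, zetaPow_zero]
  inv_val := by rw [← zetaPow_add, neg_add_cancel, zetaPow_zero]

theorem zetaUnit_natCast (m : ℕ) : zetaUnit hζ (m : ZMod (p ^ n)) = zetaUnit hζ 1 ^ m := by
  refine Units.ext (Subtype.ext ?_)
  have h := coe_zetaPow_natCast hζ 1
  rw [Nat.cast_one, pow_one] at h
  change (zetaPow hζ _ : K) = ((zetaPow hζ 1 ^ m : cycRing p n K) : K)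
  rw [coe_zetaPow_natCast, Subalgebra.coe_pow, h]

theorem zetaUnit_mem_biorth (x : ZMod (p ^ n)) : zetaUnit hζ x ∈ biorth (zetaUnit hζ 1) := by
  obtain ⟨m, rfl⟩ := ZMod.natCast_zmod_surjective x
  rw [zetaUnit_natCast]
  exact pow_mem (self_mem_biorth _) m

theorem zetaPow_two_mul (x : ZMod (p ^ n)) : zetaPow hζ (2 * x) = zetaPow hζ x ^ 2 := by
  rw [two_mul, zetaPow_add, sq]

theorem zetaPow_three_mul (x : ZMod (p ^ n)) : zetaPow hζ (3 * x) = zetaPow hζ x ^ 3 := by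
  rw [show 3 * x = x + (x + x) by ring, zetaPow_add, zetaPow_add]
  ring

variable [NumberField K]

open Classical in
/-- The unit `1 - ζ^x`, or `1` when `x = 0`. -/
noncomputable def oneSubUnit (x : ZMod (p ^ n)) : (cycRing p n K)ˣ :=
  if hx : x ≠ 0 then cycUnit hζ hx else 1

theorem oneSubUnit_zero : oneSubUnit hζ 0 = 1 := dif_neg (not_not.2 rfl)

theorem val_oneSubUnit {x : ZMod (p ^ n)} (hx : x ≠ 0) :
    (oneSubUnit hζ x : cycRing p n K) = 1 - zetaPow hζ x := by
  rw [oneSubUnit, dif_pos hx]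
  rfl

/-- The symbol `{1 - ζ^x, 1 - ζ^y}`, or `0` when `x = 0` or `y = 0`. -/
noncomputable def cycSymbol (x y : ZMod (p ^ n)) : K2tilde (cycRing p n K) :=
  symbol (oneSubUnit hζ x) (oneSubUnit hζ y)

/-- A symbol with an entry 1 vanishes, so the value 1 of `oneSubUnit` at 0 reproduces the default
value 0 of e_n. -/
theorem steinbergManin_eq (v : ManinX (p ^ n)) :
    steinbergManin hζ v = cycSymbol hζ v.1.1 v.1.2 := by
  rw [steinbergManin, cycSymbol]
  split_ifs with h
  · rw [oneSubUnit, oneSubUnit, dif_pos h.1, dif_pos h.2]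
  · rw [not_and_or, not_not, not_not] at h
    rcases h with h | h
    · rw [h, oneSubUnit_zero, symbol_one_left]
    · rw [h, oneSubUnit_zero, symbol_one_right]

/-- The symbol {1 - ζ^m, ζ} is killed by m, by the Steinberg relation, and by p^n, the order of ζ;
these are coprime. -/
theorem oneSubUnit_mem_orth_of_coprime {m : ℕ} (hm : m.Coprime (p ^ n)) :
    oneSubUnit hζ (m : ZMod (p ^ n)) ∈ orth (zetaUnit hζ 1) := by
  change symbol _ _ = 0
  by_cases hm0 : (m : ZMod (p ^ n)) = 0
  · rw [hm0, oneSubUnit_zero, symbol_one_left]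
  have h1 : symbol (oneSubUnit hζ (m : ZMod (p ^ n))) (zetaUnit hζ 1 ^ m) = 0 := by
    rw [← zetaUnit_natCast]
    refine symbol_of_add _ _ (Or.inr ?_)
    rw [val_oneSubUnit hζ hm0]
    exact sub_add_cancel _ _
  have h2 : symbol (oneSubUnit hζ (m : ZMod (p ^ n))) (zetaUnit hζ 1 ^ (p ^ n)) = 0 := by
    rw [← zetaUnit_natCast, ZMod.natCast_self]
    convert symbol_one_right _
    exact Units.ext (zetaPow_zero hζ)
  rw [symbol_pow_right, ← natCast_zsmul] at h1 h2
  obtain ⟨a, b, hab⟩ := Nat.isCoprime_iff_coprime.2 hm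
  rw [← one_zsmul (symbol _ _), ← hab, add_zsmul, mul_zsmul, mul_zsmul, h1, h2, smul_zero,
    smul_zero, add_zero]

/-- The symbols `{1 - ζ^x, ζ}` vanish. -/
theorem oneSubUnit_mem_orth (x : ZMod (p ^ n)) :
    oneSubUnit hζ x ∈ orth (zetaUnit hζ 1) := by
  have hp : p.Prime := Fact.out
  by_cases hx : x = 0
  · rw [hx, oneSubUnit_zero]
    exact one_mem _
  have hx0 : x.val ≠ 0 := fun h => hx ((ZMod.val_eq_zero x).1 h)
  obtain ⟨k, y, hy, hxy⟩ := Nat.exists_eq_pow_mul_and_not_dvd hx0 p hp.ne_one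
  have hk : k < n := by
    have h1 : p ^ k ≤ x.val := Nat.le_of_dvd (Nat.pos_of_ne_zero hx0) ⟨y, hxy⟩
    exact (Nat.pow_lt_pow_iff_right hp.one_lt).1 (h1.trans_lt (ZMod.val_lt x))
  -- Since k < n, the exponent l + 1 is positive, so adding multiples of p^(l+1) to y keeps it prime
  -- to p.
  obtain ⟨l, rfl⟩ : ∃ l, n = k + (l + 1) := ⟨n - k - 1, by omega⟩
  have hcop : ∀ i, (y + i * p ^ (l + 1)).Coprime (p ^ (k + (l + 1))) := by
    intro i
    refine Nat.Coprime.pow_right _ ((Nat.Prime.coprime_iff_not_dvd hp).2 fun h => hy ?_).symm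
    exact (Nat.dvd_add_left ((dvd_pow_self p (Nat.succ_ne_zero l)).mul_left i)).1 h
  have hne : ∀ i, ((y + i * p ^ (l + 1) : ℕ) : ZMod (p ^ (k + (l + 1)))) ≠ 0 := by
    intro i h
    rw [ZMod.natCast_eq_zero_iff] at h
    have h1 := Nat.Coprime.eq_one_of_dvd (hcop i).symm h
    exact (Nat.one_lt_pow (by omega) hp.one_lt).ne' h1
  have hη : IsPrimitiveRoot (ζ ^ p ^ (l + 1)) (p ^ k) :=
    hζ.pow (pow_pos hp.pos _) (by rw [← pow_add, add_comm])
  -- The distribution relation 1 - T^(p^k) = ∏ (1 - η^i T) at T = ζ^y, with η = ζ^(p^(l+1)), reduces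
  -- to exponents prime to p.
  have hprod : oneSubUnit hζ x = ∏ i ∈ Finset.range (p ^ k),
      oneSubUnit hζ ((y + i * p ^ (l + 1) : ℕ) : ZMod (p ^ (k + (l + 1)))) := by
    refine Units.ext (Subtype.ext ?_)
    rw [val_oneSubUnit hζ hx, Units.coe_prod, SubmonoidClass.coe_finsetProd]
    have h1 : ((1 - zetaPow hζ x : cycRing p (k + (l + 1)) K) : K) = 1 - (ζ ^ y) ^ p ^ k := by
      change 1 - ζ ^ x.val = _
      rw [hxy, ← pow_mul, mul_comm]
    rw [h1, one_sub_pow_eq_prod (pow_pos hp.pos k) hη]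
    refine Finset.prod_congr rfl fun i _ => ?_
    rw [val_oneSubUnit hζ (hne i)]
    change _ = 1 - (zetaPow hζ _ : K)
    rw [coe_zetaPow_natCast, ← pow_mul, ← pow_add, mul_comm i, add_comm y]
  rw [hprod]
  exact prod_mem fun i _ => oneSubUnit_mem_orth_of_coprime hζ (hcop i)

theorem oneSubUnit_neg (x : ZMod (p ^ n)) :
    ∃ w ∈ biorth (zetaUnit hζ 1), oneSubUnit hζ (-x) = w * oneSubUnit hζ x := by
  by_cases hx : x = 0
  · exact ⟨1, one_mem _, by rw [hx, neg_zero, one_mul]⟩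
  · refine ⟨-zetaUnit hζ (-x), neg_mem_biorth (zetaUnit_mem_biorth hζ _), Units.ext ?_⟩
    have h : zetaPow hζ (-x) * zetaPow hζ x = 1 := by
      rw [← zetaPow_add, neg_add_cancel, zetaPow_zero]
    rw [Units.val_mul, Units.val_neg, val_oneSubUnit hζ hx, val_oneSubUnit hζ (neg_ne_zero.2 hx)]
    change _ = -zetaPow hζ (-x) * _
    linear_combination -h

theorem cycSymbol_zero_left (y : ZMod (p ^ n)) : cycSymbol hζ 0 y = 0 := by
  rw [cycSymbol, oneSubUnit_zero, symbol_one_left]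

theorem cycSymbol_zero_right (x : ZMod (p ^ n)) : cycSymbol hζ x 0 = 0 := by
  rw [cycSymbol, oneSubUnit_zero, symbol_one_right]

theorem cycSymbol_self (x : ZMod (p ^ n)) : cycSymbol hζ x x = 0 := symbol_self _

theorem cycSymbol_swap (x y : ZMod (p ^ n)) : cycSymbol hζ x y = -cycSymbol hζ y x :=
  symbol_swap _ _

/-- The units 1 - ζ^(-y) and 1 - ζ^y differ by -ζ^(-y), whose symbols with cyclotomic units vanish.
-/
theorem cycSymbol_neg_right (x y : ZMod (p ^ n)) : cycSymbol hζ x (-y) = cycSymbol hζ x y := by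
  obtain ⟨w, hw, h⟩ := oneSubUnit_neg hζ y
  rw [cycSymbol, h, symbol_mul_right, hw.2 _ (oneSubUnit_mem_orth hζ x), zero_add, cycSymbol]

theorem cycSymbol_neg_left (x y : ZMod (p ^ n)) : cycSymbol hζ (-x) y = cycSymbol hζ x y := by
  rw [cycSymbol_swap, cycSymbol_neg_right, ← cycSymbol_swap]

/-- The three-term relation between the symbols `{1 - ζ^x, 1 - ζ^y}`. -/
theorem cycSymbol_eq_add (x y : ZMod (p ^ n)) :
    cycSymbol hζ x y = cycSymbol hζ x (x + y) + cycSymbol hζ (x + y) y := by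
  by_cases hx : x = 0
  · rw [hx, zero_add, cycSymbol_zero_left, cycSymbol_self, add_zero]
  by_cases hy : y = 0
  · rw [hy, add_zero, cycSymbol_zero_right, cycSymbol_self, add_zero]
  by_cases hxy : x + y = 0
  · rw [hxy, cycSymbol_zero_left, cycSymbol_zero_right, eq_neg_of_add_eq_zero_right hxy,
      cycSymbol_neg_right, cycSymbol_self, add_zero]
  -- With X = ζ^x and Y = ζ^y: (1 - X) + X(1 - Y) = 1 - XY.
  refine symbol_eq_add (oneSubUnit_mem_orth hζ _) (oneSubUnit_mem_orth hζ _)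
    (oneSubUnit_mem_orth hζ _) (one_mem _) (zetaUnit_mem_biorth hζ x) ?_
  rw [val_oneSubUnit hζ hx, val_oneSubUnit hζ hy, val_oneSubUnit hζ hxy, zetaPow_add,
    Units.val_one]
  change 1 * _ + zetaPow hζ x * _ = _
  ring

/-! ### Relations between the quotients (1 - ζ^(qx))/(1 - ζ^x) for q = 2, 3 -/

/-- The unit `(1 - ζ^{qx}) / (1 - ζ^x)`. -/
noncomputable def quotUnit (q x : ZMod (p ^ n)) : (cycRing p n K)ˣ :=
  oneSubUnit hζ (q * x) * (oneSubUnit hζ x)⁻¹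

theorem quotUnit_mem_orth (q x : ZMod (p ^ n)) : quotUnit hζ q x ∈ orth (zetaUnit hζ 1) :=
  mul_mem (oneSubUnit_mem_orth hζ _) (inv_mem (oneSubUnit_mem_orth hζ _))

theorem oneSubUnit_mul (q x : ZMod (p ^ n)) :
    oneSubUnit hζ (q * x) = quotUnit hζ q x * oneSubUnit hζ x :=
  (inv_mul_cancel_right _ _).symm

theorem val_quotUnit {q x : ZMod (p ^ n)} (hq : IsUnit q) (hx : x ≠ 0) {r : cycRing p n K}
    (h : 1 - zetaPow hζ (q * x) = r * (1 - zetaPow hζ x)) :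
    (quotUnit hζ q x : cycRing p n K) = r := by
  rw [quotUnit, Units.val_mul, Units.mul_inv_eq_iff_eq_mul, val_oneSubUnit hζ hx,
    val_oneSubUnit hζ fun h => hx (hq.mul_right_eq_zero.1 h), h]

theorem val_quotUnit_two (h2 : IsUnit (2 : ZMod (p ^ n))) {x : ZMod (p ^ n)} (hx : x ≠ 0) :
    (quotUnit hζ 2 x : cycRing p n K) = 1 + zetaPow hζ x :=
  val_quotUnit hζ h2 hx (by rw [zetaPow_two_mul]; ring)

theorem val_quotUnit_three (h3 : IsUnit (3 : ZMod (p ^ n))) {x : ZMod (p ^ n)} (hx : x ≠ 0) :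
    (quotUnit hζ 3 x : cycRing p n K) = 1 + zetaPow hζ x + zetaPow hζ x ^ 2 :=
  val_quotUnit hζ h3 hx (by rw [zetaPow_three_mul]; ring)

theorem cycSymbol_mul_left (q x y : ZMod (p ^ n)) :
    cycSymbol hζ (q * x) y = symbol (quotUnit hζ q x) (oneSubUnit hζ y) + cycSymbol hζ x y := by
  rw [cycSymbol, oneSubUnit_mul, symbol_mul_left, cycSymbol]

theorem cycSymbol_mul_right (q x y : ZMod (p ^ n)) :
    cycSymbol hζ x (q * y) = symbol (oneSubUnit hζ x) (quotUnit hζ q y) + cycSymbol hζ x y := by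
  rw [cycSymbol, oneSubUnit_mul, symbol_mul_right, cycSymbol]

theorem cycSymbol_mul_mul (q x y : ZMod (p ^ n)) :
    cycSymbol hζ (q * x) (q * y) = symbol (quotUnit hζ q x) (quotUnit hζ q y) +
      symbol (quotUnit hζ q x) (oneSubUnit hζ y) +
      (symbol (oneSubUnit hζ x) (quotUnit hζ q y) + cycSymbol hζ x y) := by
  rw [cycSymbol_mul_left, oneSubUnit_mul, symbol_mul_right, cycSymbol_mul_right]

/-- This is the identity (1 + X) - X(1 + Y) = 1 - XY. -/
theorem symbol_quotUnit_two (h2 : IsUnit (2 : ZMod (p ^ n))) {x y : ZMod (p ^ n)}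
    (hx : x ≠ 0) (hy : y ≠ 0) (hxy : x + y ≠ 0) :
    symbol (quotUnit hζ 2 x) (quotUnit hζ 2 y) =
      symbol (quotUnit hζ 2 x) (oneSubUnit hζ (x + y)) +
        symbol (oneSubUnit hζ (x + y)) (quotUnit hζ 2 y) := by
  refine symbol_eq_add (quotUnit_mem_orth hζ _ _) (quotUnit_mem_orth hζ _ _)
    (oneSubUnit_mem_orth hζ _) (one_mem _) (neg_mem_biorth (zetaUnit_mem_biorth hζ x)) ?_
  rw [val_quotUnit_two hζ h2 hx, val_quotUnit_two hζ h2 hy, val_oneSubUnit hζ hxy, zetaPow_add,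
    Units.val_one, Units.val_neg]
  change 1 * _ + -zetaPow hζ x * _ = _
  ring

/-- The identity (1 + Y + Y²) - (Y/X)(1 + X + X²) = (1 - XY)(1 - Y/X) has a product on the right,
whence twice as many terms as for q = 2. -/
theorem symbol_quotUnit_three (h3 : IsUnit (3 : ZMod (p ^ n))) {x y : ZMod (p ^ n)}
    (hx : x ≠ 0) (hy : y ≠ 0) (hxy : x + y ≠ 0) (hyx : y - x ≠ 0) :
    symbol (quotUnit hζ 3 x) (quotUnit hζ 3 y) =
      symbol (quotUnit hζ 3 x) (oneSubUnit hζ (x + y)) +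
        symbol (quotUnit hζ 3 x) (oneSubUnit hζ (y - x)) +
        (symbol (oneSubUnit hζ (x + y)) (quotUnit hζ 3 y) +
          symbol (oneSubUnit hζ (y - x)) (quotUnit hζ 3 y)) := by
  rw [← symbol_mul_left, ← symbol_mul_right]
  refine symbol_eq_add (quotUnit_mem_orth hζ _ _) (quotUnit_mem_orth hζ _ _)
    (mul_mem (oneSubUnit_mem_orth hζ _) (oneSubUnit_mem_orth hζ _))
    (neg_mem_biorth (zetaUnit_mem_biorth hζ (y - x))) (one_mem _) ?_
  have h1 : zetaPow hζ y = zetaPow hζ (y - x) * zetaPow hζ x := by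
    rw [← zetaPow_add, sub_add_cancel]
  rw [val_quotUnit_three hζ h3 hx, val_quotUnit_three hζ h3 hy, Units.val_mul,
    val_oneSubUnit hζ hxy, val_oneSubUnit hζ hyx, zetaPow_add, Units.val_one, Units.val_neg, h1]
  change -zetaPow hζ (y - x) * _ + 1 * _ = _
  ring

/-- The relation which computes `e_n|T_2` away from `∞`. -/
theorem cycSymbol_hecke_two (h2 : IsUnit (2 : ZMod (p ^ n))) {x y : ZMod (p ^ n)}
    (hx : x ≠ 0) (hy : y ≠ 0) :
    cycSymbol hζ x (2 * y) + cycSymbol hζ (2 * x) y + cycSymbol hζ (2 * x) (x + y) +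
      cycSymbol hζ (x + y) (2 * y) =
    2 • cycSymbol hζ x y + cycSymbol hζ (2 * x) (2 * y) := by
  -- In this case 1 - ζ^(x+y) is not a unit; the terms vanish or cancel by antisymmetry.
  by_cases hxy : x + y = 0
  · rw [hxy, eq_neg_of_add_eq_zero_right hxy, mul_neg]
    simp only [cycSymbol_neg_right, cycSymbol_self, cycSymbol_zero_left, cycSymbol_zero_right]
    rw [cycSymbol_swap]
    simp
  rw [cycSymbol_mul_mul]
  simp only [cycSymbol_mul_left, cycSymbol_mul_right]
  exact add_eq_of_two_relations (cycSymbol_eq_add hζ x y) (symbol_quotUnit_two hζ h2 hx hy hxy)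

/-- The relation which computes `e_n|T_3` away from `∞`. -/
theorem cycSymbol_hecke_three (h3 : IsUnit (3 : ZMod (p ^ n))) {x y : ZMod (p ^ n)}
    (hx : x ≠ 0) (hy : y ≠ 0) :
    cycSymbol hζ x (3 * y) + cycSymbol hζ (3 * x) y + cycSymbol hζ (3 * x) (x + y) +
      cycSymbol hζ (x + y) (3 * y) + cycSymbol hζ (3 * x) (y - x) +
      cycSymbol hζ (y - x) (-(3 * y)) =
    3 • cycSymbol hζ x y + cycSymbol hζ (3 * x) (3 * y) := by
  rw [cycSymbol_neg_right]
  by_cases hxy : x + y = 0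
  · rw [hxy, eq_neg_of_add_eq_zero_right hxy, mul_neg, ← neg_add']
    simp only [cycSymbol_neg_right, cycSymbol_neg_left, cycSymbol_self, cycSymbol_zero_left,
      cycSymbol_zero_right]
    rw [cycSymbol_swap, cycSymbol_swap hζ (x + x)]
    simp
  by_cases hyx : y - x = 0
  · rw [hyx, sub_eq_zero.1 hyx]
    simp only [cycSymbol_self, cycSymbol_zero_left, cycSymbol_zero_right]
    rw [cycSymbol_swap, cycSymbol_swap hζ (x + x)]
    simp
  -- Symbols do not see the sign of x, so the three-term relation at (-x, y) decomposes the same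
  -- symbol through y - x.
  have hD := cycSymbol_eq_add hζ (-x) y
  rw [cycSymbol_neg_left, cycSymbol_neg_left, neg_add_eq_sub] at hD
  rw [cycSymbol_mul_mul]
  simp only [cycSymbol_mul_left, cycSymbol_mul_right]
  exact add_eq_of_three_relations (cycSymbol_eq_add hζ x y) hD
    (symbol_quotUnit_three hζ h3 hx hy hxy hyx)

variable [IsCyclotomicExtension {p ^ n} ℚ K]

theorem artinChar_smul_cycSymbol (u : (ZMod (p ^ n))ˣ) (x y : ZMod (p ^ n)) :
    (artinChar p n K u : MonoidAlgebra ℤ Gal(K/ℚ)) • cycSymbol hζ x y =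
      cycSymbol hζ (u * x) (u * y) := by
  set σ : Gal(K/ℚ) := (IsCyclotomicExtension.Rat.galEquivZMod (p ^ n) K).symm u with hσ
  have h1 : (artinChar p n K u : MonoidAlgebra ℤ Gal(K/ℚ)) = MonoidAlgebra.of ℤ Gal(K/ℚ) σ := rfl
  have h2 : ∀ x : ZMod (p ^ n),
      Units.map (MulSemiringAction.toRingHom Gal(K/ℚ) (cycRing p n K) σ :
        cycRing p n K →* cycRing p n K) (oneSubUnit hζ x) = oneSubUnit hζ (u * x) := by
    intro x
    by_cases hx : x = 0
    · rw [hx, mul_zero, oneSubUnit_zero, map_one]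
    have hux : (u : ZMod (p ^ n)) * x ≠ 0 := fun h => hx (u.isUnit.mul_right_eq_zero.1 h)
    refine Units.ext (Subtype.ext ?_)
    change σ ((oneSubUnit hζ x : cycRing p n K) : K) = _
    rw [val_oneSubUnit hζ hx, val_oneSubUnit hζ hux]
    change σ (1 - ζ ^ x.val) = 1 - (zetaPow hζ (u * x) : K)
    have h3 := IsCyclotomicExtension.Rat.galEquivZMod_apply_of_pow_eq (p ^ n) K σ hζ.pow_eq_one
    rw [hσ, MulEquiv.apply_symm_apply, ← hσ] at h3
    have h4 : (u : ZMod (p ^ n)) * x = ((u.val.val * x.val : ℕ) : ZMod (p ^ n)) := by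
      rw [Nat.cast_mul, ZMod.natCast_zmod_val, ZMod.natCast_zmod_val]
    rw [map_sub, map_one, map_pow, h3, h4, coe_zetaPow_natCast, pow_mul]
  rw [h1, cycSymbol, of_smul_symbol, h2, h2, cycSymbol]

theorem steinbergManin_mem_Manin :
    steinbergManin hζ ∈ Manin (artinChar p n K) (K2tilde (cycRing p n K)) := by
  refine ⟨fun u v => ?_, fun v => ?_, fun v => ?_⟩
  · rw [steinbergManin_eq, steinbergManin_eq, artinChar_smul_cycSymbol]
    rfl
  · rw [steinbergManin_eq, steinbergManin_eq]
    change _ + cycSymbol hζ v.1.2 (-v.1.1) = 0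
    rw [cycSymbol_neg_right, cycSymbol_swap, neg_add_cancel]
  · rw [steinbergManin_eq, steinbergManin_eq, steinbergManin_eq]
    change _ + cycSymbol hζ v.1.2 (-v.1.1 - v.1.2) + cycSymbol hζ (-v.1.1 - v.1.2) v.1.1 = 0
    rw [← neg_add', cycSymbol_neg_right, cycSymbol_neg_left, cycSymbol_eq_add,
      cycSymbol_swap hζ v.1.2, cycSymbol_swap hζ _ v.1.1]
    abel

end CyclotomicSymbols

/-! ### The main theorem -/

theorem smul_mem_Manin {N : ℕ} {A : Type*} [Ring A] {χ : (ZMod N)ˣ →* Aˣ} {M : Type*}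
    [AddCommGroup M] [Module A M] {a : A} (ha : ∀ u, Commute a (χ u : A)) {e : ManinX N → M}
    (he : e ∈ Manin χ M) : a • e ∈ Manin χ M := by
  refine ⟨fun u v => ?_, fun v => ?_, fun v => ?_⟩ <;> simp only [Pi.smul_apply]
  · rw [he.1, ← mul_smul, ← mul_smul, (ha u).eq]
  · rw [← smul_add, he.2.1, smul_zero]
  · rw [← smul_add, ← smul_add, he.2.2, smul_zero]

theorem mainTheorem4 (p n : ℕ) [Fact p.Prime] (hn : 1 ≤ n)
    (K : Type*) [Field K] [NumberField K] [IsCyclotomicExtension {p ^ n} ℚ K]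
    (ζ : K) (hζ : IsPrimitiveRoot ζ (p ^ n)) :
    steinbergManin hζ ∈ Manin (artinChar p n K) (K2tilde (cycRing p n K)) ∧
    ∃ φ : Symb (artinChar p n K) (K2tilde (cycRing p n K)),
      (∀ ψ : Symb (artinChar p n K) (K2tilde (cycRing p n K)),
        maninOf ψ = steinbergManin hζ ↔ ψ = φ) ∧
      ∀ q : ℕ, q = 2 ∨ q = 3 → ∀ hq : q.Coprime (p ^ n),
        maninOf (heckeT (artinChar p n K) q φ) -
            ((q : MonoidAlgebra ℤ Gal(K/ℚ)) +
              (artinChar p n K (ZMod.unitOfCoprime q hq) : MonoidAlgebra ℤ Gal(K/ℚ))) •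
              steinbergManin hζ ∈
          ManinInf (artinChar p n K) (K2tilde (cycRing p n K)) := by
  have hmem := steinbergManin_mem_Manin hζ
  obtain ⟨φ, hφ⟩ := exists_maninOf_eq hmem
  refine ⟨hmem, φ, fun ψ => ⟨fun h => maninOf_injective (h.trans hφ.symm), fun h => h ▸ hφ⟩,
    fun q hq23 hq => ⟨sub_mem (maninOf_mem_Manin _) (smul_mem_Manin (fun u => ?_) hmem), ?_⟩⟩
  -- The values of χ commute with each other because (ℤ/p^n)ˣ is commutative, so q + σ_q preserves
  -- Manin symbols.
  · refine (Nat.cast_commute q _).add_left ?_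
    rw [Commute, SemiconjBy, ← Units.val_mul, ← Units.val_mul, ← map_mul, ← map_mul, mul_comm]
  · intro v hv
    have hx := left_ne_zero_of_mul hv
    have hy := right_ne_zero_of_mul hv
    have hE := fun v => (congrFun hφ v).trans (steinbergManin_eq hζ v)
    have hqu : IsUnit (q : ZMod (p ^ n)) := (ZMod.isUnit_iff_coprime _ _).2 hq
    rw [Pi.sub_apply, Pi.smul_apply, steinbergManin_eq, add_smul, artinChar_smul_cycSymbol,
      ZMod.coe_unitOfCoprime, Nat.cast_smul_eq_nsmul, sub_eq_zero]
    rcases hq23 with rfl | rfl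
    · rw [maninOf_heckeT_two hq φ (E := cycSymbol hζ) hE]
      exact cycSymbol_hecke_two hζ hqu hx hy
    · rw [maninOf_heckeT_three hq φ (E := cycSymbol hζ) hE]
      exact cycSymbol_hecke_three hζ hqu hx hy
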